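/- Let $\Gamma$ be a group or a monoid. All schemes are over $\mathbb{Z}[1/2]$. **Representations with unipotent mold.** For a scheme $X$ and a homomorphism of monoids $\rho : \Gamma \to \mathrm{M}_2(\Gamma(X,\mathcal{O}_X))$, let $\mathcal{O}_X[\rho(\Gamma)] \subseteq \mathrm{M}_2(\mathcal{O}_X)$ be the sheaf of $\mathcal{O}_X$-subalgebras generated by $\rho(\Gamma)$. We say that $\rho$ has a *unipotent mold* if $\mathcal{O}_X[\rho(\Gamma)]$ is locally free of rank $2$, $\mathrm{M}_2(\mathcal{O}_X)/\mathcal{O}_X[\rho(\Gamma)]$ is locally free, and $\mathrm{tr}(s)^2 - 4\det(s) = 0$ for every local section $s$ of $\mathcal{O}_X[\rho(\Gamma)]$. Let $\mathrm{Rep}_2(\Gamma)_u$ be the subscheme of the representation variety $\mathrm{Rep}_2(\Gamma)[1/2]$ whose $X$-valued points are exactly the $\rho$ with unipotent mold: the closed subscheme given by the vanishing of $\mathrm{tr}(\rho(\gamma))^2 - 4\det(\rho(\gamma))$ for all $\gamma$ and of the $3\times 3$ minors of the $4 \times 3$ matrices formed by the entries of $\rho(\alpha),\rho(\beta),\rho(\gamma)$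 for all $\alpha, \beta, \gamma$, intersected with the open locus where not all $\rho(\gamma)$ are scalar. **The target.** Let $A = A_1(\Gamma)[1/2]$ be the coordinate ring of the scheme $\mathrm{Rep}_1(\Gamma)[1/2]$ of characters of $\Gamma$, let $\chi_\Gamma : \Gamma \to A$ be the universal character, and let $$\Omega_\Gamma = \Big(\bigoplus_{\gamma\in\Gamma} A\, d\gamma\Big) \Big/ \big\langle \chi_\Gamma(\gamma)\,d\delta + \chi_\Gamma(\delta)\,d\gamma - d(\gamma\delta) \;\big|\; \gamma,\delta\in\Gamma\big\rangle .$$ Put $\mathrm{Ch}_2(\Gamma)_u = \mathrm{Proj}\, S(\Omega_\Gamma)$, where $S(\Omega_\Gamma)$ is the symmetric algebra of $\Omega_\Gamma$ over $A$. **The morphism.** For a $2\times 2$ matrix $M$ put $\eta(M) = M - \tfrac{1}{2}\mathrm{tr}(M) I_2$. Let $\rho$ be the universal representation on $\mathrm{Rep}_2(\Gamma)_u$. Then $r = \mathrm{tr}(\rho)/2$ is a character of $\Gamma$. For $\alpha\in\Gamma$, on the open subscheme $\mathrm{Rep}_2(\Gamma)_{u,\alpha}$ where $\rho(\alpha)$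 is nowhere scalar, $\eta(\rho(\gamma)) = a_\alpha(\gamma)\,\eta(\rho(\alpha))$ for a unique function $a_\alpha$ on $\Gamma$, which is a derivation with respect to $r$ with $a_\alpha(\alpha) = 1$. The homomorphism $S(\Omega_\Gamma) \to \Gamma(\mathrm{Rep}_2(\Gamma)_{u,\alpha},\mathcal{O})$ given by $\chi_\Gamma(\gamma) \mapsto r(\gamma)$ and $d\gamma \mapsto a_\alpha(\gamma)$ defines a morphism $\mathrm{Rep}_2(\Gamma)_{u,\alpha} \to \mathrm{Ch}_2(\Gamma)_u$, and these morphisms glue to a morphism $\pi_{\Gamma,u} : \mathrm{Rep}_2(\Gamma)_u \to \mathrm{Ch}_2(\Gamma)_u$. **The action.** Let $\mathrm{PGL}_2[1/2]$ be the group scheme over $\mathbb{Z}[1/2]$ representing $X \mapsto \mathrm{Aut}_{\mathcal{O}_X\text{-alg}}(\mathrm{M}_2(\mathcal{O}_X))$. It acts on $\mathrm{Rep}_2(\Gamma)_u$ on the right by $(\rho,\varphi) \mapsto \varphi^{-1}\circ\rho$, that is, by $\rho \mapsto P^{-1}\rho P$. **Geometric quotients.** Let a group scheme $G$ over $S$ act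 on an $S$-scheme $X$ by $\sigma : X\times_S G \to X$. A morphism $\pi : X \to Y$ over $S$ is a *geometric quotient* by $G$ if (i) $\pi\circ\sigma = \pi\circ \mathrm{pr}_1$; (ii) $\pi$ is surjective and $(\sigma,\mathrm{pr}_1)$ maps $X\times_S G$ onto $X\times_Y X$; (iii) $\pi$ is submersive, i.e. a subset of $Y$ is open if and only if its preimage in $X$ is open; (iv) $\mathcal{O}_Y \to \pi_*\mathcal{O}_X$ is injective, with image the subsheaf of $G$-invariant functions (the sections $f$ with $\sigma^*f = \mathrm{pr}_1^*f$). It is a *universal geometric quotient* if for every morphism $Y'\to Y$ the base change $X\times_Y Y' \to Y'$ is a geometric quotient by $G$. **Theorem.** The scheme $\mathrm{Rep}_2(\Gamma)_u$ represents the functor of representations with unipotent mold on $\mathbb{Z}[1/2]$-schemes, $(\rho,\varphi)\mapsto\varphi^{-1}\circ\rho$ is a right action of $\mathrm{PGL}_2[1/2]$ on it, and the morphism $\pi_{\Gamma,u} : \mathrm{Rep}_2(\Gamma)_u \to \mathrm{Ch}_2(\Gamma)_u$ is a universal geometric quotient by $\mathrm{PGL}_2[1/2]$. -/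

import Mathlib

open CategoryTheory Limits AlgebraicGeometry MonoidalCategory CartesianMonoidalCategory Opposite

universe u

namespace UnipotentMold

noncomputable section

/-- The ring `ℤ[1/2]`. -/
def ZHalf : Type u := ULift.{u} (Localization.Away (2 : ℤ))

instance : CommRing ZHalf.{u} := inferInstanceAs (CommRing (ULift.{u} (Localization.Away (2 : ℤ))))

/-- `ZHalf` is a copy of `ℤ[1/2]` in the universe `u`. -/
def zHalfEquiv : ZHalf.{u} ≃+* Localization.Away (2 : ℤ) := ULift.ringEquiv

/-- The base scheme `Spec ℤ[1/2]`. -/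
abbrev SHalf : Scheme.{u} := Spec (.of ZHalf.{u})

lemma isUnit_two_zHalf : IsUnit (2 : ZHalf.{u}) := by
  have h : IsUnit (2 : Localization.Away (2 : ℤ)) := by
    simpa using IsLocalization.Away.algebraMap_isUnit (S := Localization.Away (2 : ℤ)) (2 : ℤ)
  have := h.map zHalfEquiv.{u}.symm
  rwa [map_ofNat] at this

/-- The structure map `ℤ[1/2] → R` of a commutative ring in which `2` is invertible. -/
def zHalfHom {R : Type*} [CommRing R] (h2 : IsUnit (2 : R)) : ZHalf.{u} →+* R :=
  (IsLocalization.Away.lift (S := Localization.Away (2 : ℤ)) (2 : ℤ)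
    (g := Int.castRingHom R) (by simpa using h2)).comp
    zHalfEquiv.{u}.toRingHom

instance subsingleton_zHalf_hom {R : Type*} [CommRing R] : Subsingleton (ZHalf.{u} →+* R) := by
  refine ⟨fun f g ↦ ?_⟩
  have h : f.comp zHalfEquiv.{u}.symm.toRingHom =
      g.comp zHalfEquiv.{u}.symm.toRingHom :=
    IsLocalization.ringHom_ext (Submonoid.powers (2 : ℤ)) (RingHom.ext_int _ _)
  ext x
  simpa using congr($h (zHalfEquiv x))

instance subsingleton_hom_sHalf (T : Scheme.{u}) : Subsingleton (T ⟶ SHalf.{u}) := by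
  refine ⟨fun f g ↦ ?_⟩
  apply (ΓSpec.adjunction.homEquiv T (op (.of ZHalf.{u}))).symm.injective
  apply Quiver.Hom.unop_inj
  ext1
  exact Subsingleton.elim (α := ZHalf.{u} →+* _) _ _

lemma isUnit_two_of_over (T : Over SHalf.{u}) : IsUnit (2 : Γ(T.left, ⊤)) := by
  have := isUnit_two_zHalf.{u}.map ((Scheme.ΓSpecIso _).inv ≫ T.hom.appTop).hom
  rwa [map_ofNat] at this

/-! ### Representation varieties -/

section Rep

variable (n : ℕ) (Γ : Type u) [Monoid Γ]

/-- The matrix of indeterminates attached to `γ`. -/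
def genericMatrix (γ : Γ) :
    Matrix (Fin n) (Fin n) (MvPolynomial (Γ × Fin n × Fin n) ZHalf.{u}) :=
  .of fun i j ↦ .X (γ, i, j)

/-- The relations saying that `γ ↦ genericMatrix n Γ γ` is a monoid homomorphism. -/
def repIdeal : Ideal (MvPolynomial (Γ × Fin n × Fin n) ZHalf.{u}) :=
  .span ({p | ∃ γ δ i j,
      p = genericMatrix n Γ (γ * δ) i j - (genericMatrix n Γ γ * genericMatrix n Γ δ) i j} ∪
    {p | ∃ i j, p = genericMatrix n Γ 1 i j - (1 : Matrix (Fin n) (Fin n) _) i j})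

/-- The coordinate ring `A_n(Γ)[1/2]` of `Rep_n(Γ)[1/2]`. -/
def RepRing : Type u := MvPolynomial (Γ × Fin n × Fin n) ZHalf.{u} ⧸ repIdeal n Γ

instance : CommRing (RepRing n Γ) := inferInstanceAs (CommRing (_ ⧸ repIdeal n Γ))

instance : Algebra ZHalf.{u} (RepRing n Γ) := inferInstanceAs (Algebra _ (_ ⧸ repIdeal n Γ))

/-- The quotient map onto `A_n(Γ)[1/2]`. -/
def repMk : MvPolynomial (Γ × Fin n × Fin n) ZHalf.{u} →+* RepRing n Γ :=
  Ideal.Quotient.mk (repIdeal n Γ)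

/-- The universal representation `σ_Γ` of degree `n`. -/
def univRep : Γ →* Matrix (Fin n) (Fin n) (RepRing n Γ) where
  toFun γ := (repMk n Γ).mapMatrix (genericMatrix n Γ γ)
  map_one' := by
    rw [← map_one (repMk n Γ).mapMatrix]
    ext i j
    exact Ideal.Quotient.eq.mpr (Ideal.subset_span (.inr ⟨i, j, rfl⟩))
  map_mul' γ δ := by
    rw [← map_mul (repMk n Γ).mapMatrix]
    ext i j
    exact Ideal.Quotient.eq.mpr (Ideal.subset_span (.inl ⟨γ, δ, i, j, rfl⟩))

variable {n Γ}

/-- The homomorphism `A_n(Γ)[1/2] → R` classifying a representation of degree `n` over `R`. -/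
def repLift {R : Type*} [CommRing R] (h2 : IsUnit (2 : R)) (ρ : Γ →* Matrix (Fin n) (Fin n) R) :
    RepRing n Γ →+* R :=
  Ideal.Quotient.lift (repIdeal n Γ)
    (MvPolynomial.eval₂Hom (zHalfHom h2) fun p ↦ ρ p.1 p.2.1 p.2.2) <| by
    have key : ∀ γ, (MvPolynomial.eval₂Hom (zHalfHom.{u} h2)
        fun p : Γ × Fin n × Fin n ↦ ρ p.1 p.2.1 p.2.2).mapMatrix (genericMatrix n Γ γ) = ρ γ := by
      intro γ
      ext i j
      simp [genericMatrix]
    intro a ha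
    rw [← RingHom.mem_ker]
    refine (Ideal.span_le.mpr ?_) ha
    rintro _ (⟨γ, δ, i, j, rfl⟩ | ⟨i, j, rfl⟩)
    · rw [SetLike.mem_coe, RingHom.mem_ker, map_sub, sub_eq_zero]
      have := congr(($(key (γ * δ))) i j)
      rw [map_mul, ← key γ, ← key δ, ← map_mul] at this
      exact this
    · rw [SetLike.mem_coe, RingHom.mem_ker, map_sub, sub_eq_zero]
      have := congr(($(key 1)) i j)
      rw [map_one, ← map_one (MvPolynomial.eval₂Hom (zHalfHom.{u} h2)
        fun p : Γ × Fin n × Fin n ↦ ρ p.1 p.2.1 p.2.2).mapMatrix] at this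
      exact this

lemma repLift_univRep {R : Type*} [CommRing R] (h2 : IsUnit (2 : R))
    (ρ : Γ →* Matrix (Fin n) (Fin n) R) (γ : Γ) :
    (repLift h2 ρ).mapMatrix (univRep n Γ γ) = ρ γ := by
  ext i j
  change MvPolynomial.eval₂Hom (zHalfHom h2) (fun p ↦ ρ p.1 p.2.1 p.2.2)
    (.X (γ, i, j)) = ρ γ i j
  simp

end Rep

/-! ### Representations with unipotent mold -/

section Unip

/-- `m(X) = tr(X)² - 4 det(X)`. -/
def disc {R : Type*} [CommRing R] (X : Matrix (Fin 2) (Fin 2) R) : R := X.trace ^ 2 - 4 * X.det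

variable {Γ : Type u} [Monoid Γ]

/-- Base change of a representation along a ring homomorphism. -/
def mapRep {n : ℕ} {R R' : Type*} [CommRing R] [CommRing R'] (f : R →+* R')
    (ρ : Γ →* Matrix (Fin n) (Fin n) R) : Γ →* Matrix (Fin n) (Fin n) R' :=
  (f.mapMatrix : Matrix (Fin n) (Fin n) R →+* Matrix (Fin n) (Fin n) R').toMonoidHom.comp ρ

/-- The determinants of order `3` formed with rows of the `4 × 3` matrix whose columns are the
entries of `ρ (g 0)`, `ρ (g 1)`, `ρ (g 2)`. -/
def minor {R : Type*} [CommRing R] (ρ : Γ →* Matrix (Fin 2) (Fin 2) R)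
    (g : Fin 3 → Γ) (r : Fin 3 → Fin 2 × Fin 2) : R :=
  Matrix.det (.of fun p q ↦ ρ (g q) (r p).1 (r p).2)

/-- The entries of `X` modulo scalar matrices: `X` is scalar iff they all vanish. -/
def coord {R : Type*} [CommRing R] (X : Matrix (Fin 2) (Fin 2) R) : Fin 3 → R :=
  ![X 0 1, X 1 0, X 0 0 - X 1 1]

/-- The representations of degree `2` of `Γ` on a scheme `T`: homomorphisms `Γ → M₂(Γ(T, 𝒪_T))`. -/
abbrev RepOn (Γ : Type u) [Monoid Γ] (T : Scheme.{u}) : Type u :=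
  Γ →* Matrix (Fin 2) (Fin 2) Γ(T, ⊤)

/-- Restriction of a matrix of global functions to an open subset. -/
def resMatrix {T : Scheme.{u}} (U : T.Opens) :
    Matrix (Fin 2) (Fin 2) Γ(T, ⊤) →+* Matrix (Fin 2) (Fin 2) Γ(T, U) :=
  (T.presheaf.map (homOfLE le_top).op).hom.mapMatrix

/-- The sections over an affine open subset `U` of the sheaf of algebras `𝒪_T[ρ(Γ)] ⊆ M₂(𝒪_T)`
generated by the image of `ρ`. -/
def imageAlgebra {T : Scheme.{u}} (ρ : RepOn Γ T) (U : T.Opens) :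
    Subalgebra Γ(T, U) (Matrix (Fin 2) (Fin 2) Γ(T, U)) :=
  Algebra.adjoin Γ(T, U) (Set.range fun γ ↦ resMatrix U (ρ γ))

/-- `𝒪_T[ρ(Γ)]` is a unipotent mold: it is a subsheaf of algebras of `M₂(𝒪_T)` of rank `2`, the
quotient `M₂(𝒪_T) / 𝒪_T[ρ(Γ)]` is locally free, and `tr(s)² - 4 det(s) = 0` for its local
sections `s`. -/
def HasUnipotentMold {T : Scheme.{u}} (ρ : RepOn Γ T) : Prop :=
  ∀ x : T, ∃ U : T.Opens, IsAffineOpen U ∧ x ∈ U ∧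
    Module.Free Γ(T, U) (imageAlgebra ρ U) ∧
    Module.finrank Γ(T, U) (imageAlgebra ρ U) = 2 ∧
    Module.Free Γ(T, U)
      (Matrix (Fin 2) (Fin 2) Γ(T, U) ⧸ Subalgebra.toSubmodule (imageAlgebra ρ U)) ∧
    ∀ s ∈ imageAlgebra ρ U, disc s = 0

variable (Γ)

/-- The equations of representations with unipotent mold: `1, ρ(α), ρ(β), ...` span a module of
rank at most `2`, and `m(ρ(γ)) = 0`. -/
def unipIdeal : Ideal (RepRing 2 Γ) :=
  .span ({a | ∃ g r, a = minor (univRep 2 Γ) g r} ∪ {a | ∃ γ, a = disc (univRep 2 Γ γ)})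

/-- The coordinate ring of the closed subscheme of `Rep₂(Γ)[1/2]` defined by `unipIdeal`. -/
def UnipRing : Type u := RepRing 2 Γ ⧸ unipIdeal Γ

instance : CommRing (UnipRing Γ) := inferInstanceAs (CommRing (_ ⧸ unipIdeal Γ))

instance : Algebra ZHalf.{u} (UnipRing Γ) := inferInstanceAs (Algebra _ (_ ⧸ unipIdeal Γ))

/-- The quotient map onto the coordinate ring. -/
def unipMk : RepRing 2 Γ →+* UnipRing Γ := Ideal.Quotient.mk (unipIdeal Γ)

/-- The restriction of the universal representation to this closed subscheme. -/
def unipRep : Γ →* Matrix (Fin 2) (Fin 2) (UnipRing Γ) :=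
  mapRep (unipMk Γ) (univRep 2 Γ)

variable {Γ} in
/-- The open subset of `Spec (UnipRing Γ)` where `a` does not vanish. -/
def basicOpenU (a : UnipRing Γ) : (Spec (.of (UnipRing Γ))).Opens := PrimeSpectrum.basicOpen a

/-- The open subset where the mold has rank exactly `2`, i.e. where the image of the representation
does not consist of scalar matrices only. -/
def nonScalarLocus : (Spec (.of (UnipRing Γ))).Opens :=
  ⨆ p : Γ × Fin 3, basicOpenU (coord (unipRep Γ p.1) p.2)

/-- The scheme `Rep₂(Γ)_u`: an open subscheme of a closed subscheme of `Rep₂(Γ)[1/2]`. -/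
abbrev RepUScheme : Scheme.{u} := (nonScalarLocus Γ).toScheme

/-- `Rep₂(Γ)_u` as a scheme over `ℤ[1/2]`. -/
abbrev RepU : Over SHalf.{u} :=
  Over.mk (Y := RepUScheme Γ) ((nonScalarLocus Γ).ι ≫
    Spec.map (CommRingCat.ofHom (algebraMap ZHalf.{u} (UnipRing Γ))))

end Unip

section
variable {Γ : Type u} [Monoid Γ]

lemma map_disc {R R' : Type*} [CommRing R] [CommRing R'] (f : R →+* R')
    (X : Matrix (Fin 2) (Fin 2) R) : disc (f.mapMatrix X) = f (disc X) := by
  simp [disc, Matrix.trace_fin_two, Matrix.det_fin_two, map_ofNat]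

lemma map_coord {R R' : Type*} [CommRing R] [CommRing R'] (f : R →+* R')
    (X : Matrix (Fin 2) (Fin 2) R) (i : Fin 3) : coord (f.mapMatrix X) i = f (coord X i) := by
  fin_cases i <;> simp [coord]

lemma map_minor {R R' : Type*} [CommRing R] [CommRing R'] (f : R →+* R')
    (ρ : Γ →* Matrix (Fin 2) (Fin 2) R) (g : Fin 3 → Γ) (r : Fin 3 → Fin 2 × Fin 2) :
    minor (mapRep f ρ) g r = f (minor ρ g r) := by
  simp [minor, mapRep, RingHom.map_det]
  rfl

/-- The conditions which define `T`-valued points of `Rep₂(Γ)_u`. -/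
structure IsUnipotentRep {T : Scheme.{u}} (ρ : RepOn Γ T) : Prop where
  isUnit_two : IsUnit (2 : Γ(T, ⊤))
  minor_eq_zero : ∀ g r, minor ρ g r = 0
  disc_eq_zero : ∀ γ, disc (ρ γ) = 0
  iSup_basicOpen : ⨆ p : Γ × Fin 3, T.basicOpen (coord (ρ p.1) p.2) = ⊤

/-- The homomorphism `UnipRing Γ → R` classifying a representation over `R`. -/
def unipLift {R : Type*} [CommRing R] (h2 : IsUnit (2 : R)) (ρ : Γ →* Matrix (Fin 2) (Fin 2) R)
    (hm : ∀ g r, minor ρ g r = 0) (hd : ∀ γ, disc (ρ γ) = 0) : UnipRing Γ →+* R :=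
  Ideal.Quotient.lift (unipIdeal Γ) (repLift h2 ρ) <| by
    intro a ha
    have hρ : mapRep (repLift h2 ρ) (univRep 2 Γ) = ρ := MonoidHom.ext (repLift_univRep h2 ρ)
    rw [← RingHom.mem_ker]
    refine (Ideal.span_le.mpr ?_) ha
    rintro _ (⟨g, r, rfl⟩ | ⟨γ, rfl⟩)
    · rw [SetLike.mem_coe, RingHom.mem_ker, ← map_minor, hρ, hm]
    · rw [SetLike.mem_coe, RingHom.mem_ker, ← map_disc, repLift_univRep, hd]

lemma unipLift_unipRep {R : Type*} [CommRing R] (h2 : IsUnit (2 : R))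
    (ρ : Γ →* Matrix (Fin 2) (Fin 2) R)
    (hm : ∀ g r, minor ρ g r = 0) (hd : ∀ γ, disc (ρ γ) = 0) (γ : Γ) :
    (unipLift h2 ρ hm hd).mapMatrix (unipRep Γ γ) = ρ γ := by
  rw [← repLift_univRep h2 ρ γ]
  rfl

/-- The ring homomorphism attached to a `T`-valued point of `Rep₂(Γ)_u`. -/
def ringOfPoint {T : Scheme.{u}} (f : T ⟶ RepUScheme Γ) : UnipRing Γ →+* Γ(T, ⊤) :=
  ((Scheme.ΓSpecIso (.of (UnipRing Γ))).inv ≫ (f ≫ (nonScalarLocus Γ).ι).appTop).hom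

/-- The representation on `T` attached to a `T`-valued point of `Rep₂(Γ)_u`: the pullback of the
universal one. -/
def pointRep {T : Scheme.{u}} (f : T ⟶ RepUScheme Γ) : RepOn Γ T :=
  mapRep (ringOfPoint f) (unipRep Γ)

lemma basicOpen_ringOfPoint {T : Scheme.{u}} (f : T ⟶ RepUScheme Γ) (a : UnipRing Γ) :
    T.basicOpen (ringOfPoint f a) =
      f ⁻¹ᵁ ((nonScalarLocus Γ).ι ⁻¹ᵁ basicOpenU a) := by
  have : _ = basicOpenU a := basicOpen_eq_of_affine (R := .of (UnipRing Γ)) a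
  rw [← this, ← Scheme.Hom.comp_preimage, Scheme.preimage_basicOpen]
  rfl

lemma isUnipotentRep_pointRep {T : Scheme.{u}} (f : T ⟶ RepUScheme Γ) :
    IsUnipotentRep (pointRep f) where
  isUnit_two := isUnit_two_of_over (Over.mk (f ≫ (RepU Γ).hom))
  minor_eq_zero g r := by
    rw [pointRep, unipRep, map_minor, map_minor]
    rw [show unipMk Γ _ = 0 from
      Ideal.Quotient.eq_zero_iff_mem.mpr (Ideal.subset_span (.inl ⟨g, r, rfl⟩)), map_zero]
  disc_eq_zero γ := by
    change disc ((ringOfPoint f).mapMatrix ((unipMk Γ).mapMatrix (univRep 2 Γ γ))) = 0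
    rw [map_disc, map_disc]
    rw [show unipMk Γ _ = 0 from
      Ideal.Quotient.eq_zero_iff_mem.mpr (Ideal.subset_span (.inr ⟨γ, rfl⟩)), map_zero]
  iSup_basicOpen := by
    have (p : Γ × Fin 3) : T.basicOpen (coord (pointRep f p.1) p.2) =
        f ⁻¹ᵁ ((nonScalarLocus Γ).ι ⁻¹ᵁ
          basicOpenU (coord (unipRep Γ p.1) p.2)) := by
      rw [← basicOpen_ringOfPoint, ← map_coord]
      rfl
    simp_rw [this]
    rw [← Scheme.Hom.preimage_iSup, ← Scheme.Hom.preimage_iSup]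
    change f ⁻¹ᵁ ((nonScalarLocus Γ).ι ⁻¹ᵁ nonScalarLocus Γ) = ⊤
    rw [Scheme.Opens.ι_preimage_self]
    rfl

/-- The `T`-valued point of `Rep₂(Γ)_u` attached to a representation. -/
def toRepU {T : Scheme.{u}} (ρ : RepOn Γ T) (h : IsUnipotentRep ρ) : T ⟶ RepUScheme Γ :=
  IsOpenImmersion.lift (nonScalarLocus Γ).ι
    (T.toSpecΓ ≫ Spec.map (CommRingCat.ofHom
      (unipLift h.isUnit_two ρ h.minor_eq_zero h.disc_eq_zero))) <| by
    rw [Scheme.Opens.range_ι]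
    rintro _ ⟨x, rfl⟩
    have hx : x ∈ ⨆ p : Γ × Fin 3, T.basicOpen (coord (ρ p.1) p.2) := by
      rw [h.iSup_basicOpen]; trivial
    obtain ⟨p, hp⟩ := TopologicalSpace.Opens.mem_iSup.mp hx
    refine TopologicalSpace.Opens.mem_iSup.mpr ⟨p, ?_⟩
    rw [← unipLift_unipRep h.isUnit_two ρ h.minor_eq_zero h.disc_eq_zero, map_coord,
      ← Scheme.toSpecΓ_preimage_basicOpen] at hp
    exact hp

lemma pointRep_toRepU {T : Scheme.{u}} (ρ : RepOn Γ T) (h : IsUnipotentRep ρ) :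
    pointRep (toRepU ρ h) = ρ := by
  ext1 γ
  have : ringOfPoint (toRepU ρ h) =
      unipLift h.isUnit_two ρ h.minor_eq_zero h.disc_eq_zero := by
    unfold ringOfPoint toRepU
    rw [IsOpenImmersion.lift_fac]
    simp
  change (ringOfPoint (toRepU ρ h)).mapMatrix _ = _
  rw [this, unipLift_unipRep]

end

section PGL

/-- The group of `R`-algebra automorphisms of `M₂(R)`. -/
abbrev MatAut (R : Type*) [CommRing R] : Type _ :=
  Matrix (Fin 2) (Fin 2) R ≃ₐ[R] Matrix (Fin 2) (Fin 2) R

section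
variable {R : Type*} [CommRing R]

/-- A system of `2 × 2` matrix units in `M₂(R)`. -/
structure IsMatrixUnits (e : Fin 2 → Fin 2 → Matrix (Fin 2) (Fin 2) R) : Prop where
  mul : ∀ k l m n, e k l * e m n = if l = m then e k n else 0
  one : ∑ k, e k k = 1

lemma isMatrixUnits_algHom
    (φ : Matrix (Fin 2) (Fin 2) R →ₐ[R] Matrix (Fin 2) (Fin 2) R) :
    IsMatrixUnits fun k l ↦ φ (Matrix.single k l 1) where
  mul k l m n := by
    rw [← map_mul]
    split_ifs with h
    · subst h; simp
    · rw [Matrix.single_mul_single_of_ne _ _ _ _ h, map_zero]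
  one := by
    rw [← map_sum, ← map_one φ]
    congr 1
    ext i j
    fin_cases i <;> fin_cases j <;> simp [Matrix.single]

/-- The endomorphism of `M₂(R)` sending the standard matrix units to given ones. -/
def unitsHom (e : Fin 2 → Fin 2 → Matrix (Fin 2) (Fin 2) R) (he : IsMatrixUnits e) :
    Matrix (Fin 2) (Fin 2) R →ₐ[R] Matrix (Fin 2) (Fin 2) R :=
  AlgHom.ofLinearMap
    { toFun X := ∑ k, ∑ l, X k l • e k l
      map_add' X Y := by simp [add_smul, Finset.sum_add_distrib]; try abel
      map_smul' c X := by simp [mul_smul] }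
    (by simpa [Fin.sum_univ_two] using he.one)
    (fun X Y ↦ by
      have h := he.mul
      simp only [LinearMap.coe_mk, AddHom.coe_mk, Fin.sum_univ_two, Matrix.mul_apply, add_mul,
        mul_add, smul_mul_smul_comm, h, add_smul]
      simp
      abel)

lemma unitsHom_apply (e : Fin 2 → Fin 2 → Matrix (Fin 2) (Fin 2) R) (he : IsMatrixUnits e)
    (X : Matrix (Fin 2) (Fin 2) R) : unitsHom e he X = ∑ k, ∑ l, X k l • e k l := rfl

lemma unitsHom_single (e : Fin 2 → Fin 2 → Matrix (Fin 2) (Fin 2) R) (he : IsMatrixUnits e)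
    (k l : Fin 2) : unitsHom e he (Matrix.single k l 1) = e k l := by
  rw [unitsHom_apply]
  fin_cases k <;> fin_cases l <;> simp [Matrix.single, Fin.sum_univ_two]

lemma matHom_ext {A : Type*} [Semiring A] [Algebra R A]
    {φ ψ : Matrix (Fin 2) (Fin 2) R →ₐ[R] A}
    (h : ∀ k l, φ (Matrix.single k l 1) = ψ (Matrix.single k l 1)) : φ = ψ := by
  ext X
  rw [Matrix.matrix_eq_sum_single X]
  have (i j : Fin 2) : Matrix.single i j (X i j) = X i j • Matrix.single i j 1 := by simp
  simp only [this, map_sum, map_smul, h]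

variable {R' : Type*} [CommRing R']

/-- Base change of an endomorphism of the algebra `M₂(R)`. -/
def mapMatHom (f : R →+* R') (φ : Matrix (Fin 2) (Fin 2) R →ₐ[R] Matrix (Fin 2) (Fin 2) R) :
    Matrix (Fin 2) (Fin 2) R' →ₐ[R'] Matrix (Fin 2) (Fin 2) R' :=
  unitsHom (fun k l ↦ f.mapMatrix (φ (Matrix.single k l 1)))
    { mul k l m n := by
        rw [← map_mul, (isMatrixUnits_algHom φ).mul]
        split_ifs <;> simp
      one := by rw [← map_sum, (isMatrixUnits_algHom φ).one, map_one] }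

lemma mapMatHom_mapMatrix (f : R →+* R')
    (φ : Matrix (Fin 2) (Fin 2) R →ₐ[R] Matrix (Fin 2) (Fin 2) R)
    (X : Matrix (Fin 2) (Fin 2) R) :
    mapMatHom f φ (f.mapMatrix X) = f.mapMatrix (φ X) := by
  have h : φ X = ∑ k, ∑ l, X k l • φ (Matrix.single k l 1) := by
    conv_lhs => rw [Matrix.matrix_eq_sum_single X]
    have (i j : Fin 2) : Matrix.single i j (X i j) = X i j • Matrix.single i j 1 := by simp
    simp only [this, map_sum, map_smul]
  rw [h, mapMatHom, unitsHom_apply]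
  ext i j
  simp [Matrix.sum_apply]

lemma mapMatrix_single (f : R →+* R') (k l : Fin 2) :
    f.mapMatrix (Matrix.single k l 1) = Matrix.single k l 1 := by
  ext i j
  simp [Matrix.single, apply_ite f]

lemma mapMatHom_id (f : R →+* R') : mapMatHom f (AlgHom.id R _) = AlgHom.id R' _ :=
  matHom_ext fun k l ↦ by
    rw [← mapMatrix_single f, mapMatHom_mapMatrix]; rfl

lemma mapMatHom_comp (f : R →+* R')
    (φ ψ : Matrix (Fin 2) (Fin 2) R →ₐ[R] Matrix (Fin 2) (Fin 2) R) :
    mapMatHom f (φ.comp ψ) = (mapMatHom f φ).comp (mapMatHom f ψ) :=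
  matHom_ext fun k l ↦ by
    rw [← mapMatrix_single f, mapMatHom_mapMatrix, AlgHom.comp_apply, AlgHom.comp_apply,
      mapMatHom_mapMatrix, mapMatHom_mapMatrix]

/-- Base change of automorphisms of `M₂`. -/
def mapAut (f : R →+* R') : MatAut R →* MatAut R' where
  toFun φ := AlgEquiv.ofAlgHom (mapMatHom f φ) (mapMatHom f φ.symm)
    (by rw [← mapMatHom_comp]; simp [mapMatHom_id]) (by rw [← mapMatHom_comp]; simp [mapMatHom_id])
  map_one' := by
    apply AlgEquiv.coe_toAlgHom_injective
    exact mapMatHom_id f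
  map_mul' φ ψ := by
    apply AlgEquiv.coe_toAlgHom_injective
    exact mapMatHom_comp f φ.toAlgHom ψ.toAlgHom

lemma mapAut_mapMatrix (f : R →+* R') (φ : MatAut R) (X : Matrix (Fin 2) (Fin 2) R) :
    mapAut f φ (f.mapMatrix X) = f.mapMatrix (φ X) :=
  mapMatHom_mapMatrix f φ.toAlgHom X

lemma matAut_ext {φ ψ : MatAut R}
    (h : ∀ k l, φ (Matrix.single k l 1) = ψ (Matrix.single k l 1)) : φ = ψ :=
  AlgEquiv.coe_toAlgHom_injective (matHom_ext h)

lemma mapAut_id (φ : MatAut R) : mapAut (RingHom.id R) φ = φ :=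
  matAut_ext fun k l ↦ by
    conv_lhs => rw [← mapMatrix_single (RingHom.id R), mapAut_mapMatrix]
    simp

lemma mapAut_comp {R'' : Type*} [CommRing R''] (g : R' →+* R'') (f : R →+* R') (φ : MatAut R) :
    mapAut (g.comp f) φ = mapAut g (mapAut f φ) :=
  matAut_ext fun k l ↦ by
    rw [← mapMatrix_single (g.comp f), mapAut_mapMatrix]
    rw [← RingHom.mapMatrix_comp, RingHom.comp_apply, RingHom.comp_apply, mapAut_mapMatrix,
      mapAut_mapMatrix]

/-- `e false` and `e true` are systems of matrix units, and the endomorphisms of the algebra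
`M₂(R)` which they define are inverse to each other. -/
structure IsAutData (e : Bool → Fin 2 → Fin 2 → Matrix (Fin 2) (Fin 2) R) : Prop where
  isMatrixUnits : ∀ b, IsMatrixUnits (e b)
  inv : ∀ b k l, ∑ p, ∑ q, e (!b) k l p q • e b p q = Matrix.single k l 1

/-- The automorphism of `M₂(R)` mapping the standard matrix units to `e false`. -/
def IsAutData.aut {e : Bool → Fin 2 → Fin 2 → Matrix (Fin 2) (Fin 2) R} (h : IsAutData e) :
    MatAut R :=
  have key (b : Bool) : (unitsHom (e b) (h.isMatrixUnits b)).comp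
      (unitsHom (e !b) (h.isMatrixUnits !b)) = AlgHom.id R _ := matHom_ext fun k l ↦ by
    rw [AlgHom.comp_apply, unitsHom_single, unitsHom_apply, AlgHom.id_apply]
    exact h.inv b k l
  AlgEquiv.ofAlgHom (unitsHom (e false) (h.isMatrixUnits _)) (unitsHom (e true) (h.isMatrixUnits _))
    (key false) (key true)

/-- The images of the matrix units under an automorphism and its inverse. -/
def autData (φ : MatAut R) (b : Bool) (k l : Fin 2) : Matrix (Fin 2) (Fin 2) R :=
  bif b then φ.symm (Matrix.single k l 1) else φ (Matrix.single k l 1)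

lemma isAutData_autData (φ : MatAut R) : IsAutData (autData φ) where
  isMatrixUnits b := by
    cases b
    · exact isMatrixUnits_algHom φ.toAlgHom
    · exact isMatrixUnits_algHom φ.symm.toAlgHom
  inv b k l := by
    have (ψ : MatAut R) (X : Matrix (Fin 2) (Fin 2) R) :
        ∑ p, ∑ q, X p q • ψ (Matrix.single p q 1) = ψ X := by
      conv_rhs => rw [Matrix.matrix_eq_sum_single X]
      have (i j : Fin 2) : Matrix.single i j (X i j) = X i j • Matrix.single i j 1 := by simp
      simp only [this, map_sum, map_smul]
    cases b
    · exact (this φ _).trans (φ.apply_symm_apply _)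
    · exact (this φ.symm _).trans (φ.symm_apply_apply _)

lemma autData_aut {e : Bool → Fin 2 → Fin 2 → Matrix (Fin 2) (Fin 2) R} (h : IsAutData e) :
    autData h.aut = e := by
  funext b k l
  cases b
  · exact unitsHom_single _ (h.isMatrixUnits _) k l
  · exact unitsHom_single _ (h.isMatrixUnits _) k l

lemma mapAut_aut {e : Bool → Fin 2 → Fin 2 → Matrix (Fin 2) (Fin 2) R} (h : IsAutData e)
    (f : R →+* R') (h' : IsAutData fun b k l ↦ f.mapMatrix (e b k l)) :
    mapAut f h.aut = h'.aut :=
  matAut_ext fun k l ↦ by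
    conv_lhs => rw [← mapMatrix_single f, mapAut_mapMatrix]
    exact congr(f.mapMatrix $(unitsHom_single _ (h.isMatrixUnits false) k l)).trans
      (unitsHom_single _ (h'.isMatrixUnits false) k l).symm

lemma aut_autData (φ : MatAut R) : (isAutData_autData φ).aut = φ :=
  matAut_ext fun k l ↦ unitsHom_single _ ((isAutData_autData φ).isMatrixUnits false) k l

lemma IsMatrixUnits.map {e : Fin 2 → Fin 2 → Matrix (Fin 2) (Fin 2) R} (h : IsMatrixUnits e)
    (f : R →+* R') : IsMatrixUnits fun k l ↦ f.mapMatrix (e k l) where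
  mul k l m n := by rw [← map_mul, h.mul]; split_ifs <;> simp
  one := by rw [← map_sum, h.one, map_one]

lemma IsAutData.map {e : Bool → Fin 2 → Fin 2 → Matrix (Fin 2) (Fin 2) R} (h : IsAutData e)
    (f : R →+* R') : IsAutData fun b k l ↦ f.mapMatrix (e b k l) where
  isMatrixUnits b := (h.isMatrixUnits b).map f
  inv b k l := by
    rw [← mapMatrix_single f, ← h.inv b k l]
    ext i j
    simp [Matrix.sum_apply]

end

/-- Matrices of indeterminates, for the images of the matrix unit `E_{kl}` under an automorphism of
`M₂` (`b = false`) and under its inverse (`b = true`). -/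
def pglGen (b : Bool) (k l : Fin 2) :
    Matrix (Fin 2) (Fin 2)
      (MvPolynomial (Bool × (Fin 2 × Fin 2) × (Fin 2 × Fin 2)) ZHalf.{u}) :=
  .of fun i j ↦ .X (b, (k, l), (i, j))

/-- The relations which define automorphisms of the algebra `M₂`. -/
def pglIdeal :
    Ideal (MvPolynomial (Bool × (Fin 2 × Fin 2) × (Fin 2 × Fin 2)) ZHalf.{u}) :=
  .span
    ({a | ∃ b k l m n i j, a = (pglGen b k l * pglGen b m n) i j -
        (if l = m then pglGen b k n else 0 : Matrix (Fin 2) (Fin 2) _) i j} ∪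
      {a | ∃ b i j, a = (∑ k, pglGen b k k) i j - (1 : Matrix (Fin 2) (Fin 2) _) i j} ∪
      {a | ∃ b k l i j, a = (∑ p, ∑ q, pglGen (!b) k l p q • pglGen b p q) i j -
        (Matrix.single k l 1 : Matrix (Fin 2) (Fin 2) _) i j})

lemma pglIdeal_le_ker {R : Type*} [CommRing R]
    (f : MvPolynomial (Bool × (Fin 2 × Fin 2) × (Fin 2 × Fin 2)) ZHalf.{u} →+* R) :
    pglIdeal ≤ RingHom.ker f ↔ IsAutData fun b k l ↦ f.mapMatrix (pglGen b k l) := by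
  have h3 (b : Bool) (k l : Fin 2) :
      ∑ p, ∑ q, f.mapMatrix (pglGen (!b) k l) p q • f.mapMatrix (pglGen b p q) =
        f.mapMatrix (∑ p, ∑ q, pglGen (!b) k l p q • pglGen b p q) := by
    ext i j
    simp [Matrix.sum_apply]
  rw [pglIdeal, Ideal.span_le]
  constructor
  · refine fun h ↦ ⟨fun b ↦ ⟨fun k l m n ↦ ?_, ?_⟩, fun b k l ↦ ?_⟩
    · rw [← map_mul]
      have (i j : Fin 2) := h (.inl (.inl ⟨b, k, l, m, n, i, j, rfl⟩))
      simp only [SetLike.mem_coe, RingHom.mem_ker, map_sub, sub_eq_zero] at this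
      trans f.mapMatrix (if l = m then pglGen b k n else 0)
      · exact Matrix.ext this
      · split_ifs <;> simp
    · rw [← map_sum, ← map_one f.mapMatrix]
      have (i j : Fin 2) := h (.inl (.inr ⟨b, i, j, rfl⟩))
      simp only [SetLike.mem_coe, RingHom.mem_ker, map_sub, sub_eq_zero] at this
      exact Matrix.ext this
    · rw [h3, ← mapMatrix_single f]
      have (i j : Fin 2) := h (.inr ⟨b, k, l, i, j, rfl⟩)
      simp only [SetLike.mem_coe, RingHom.mem_ker, map_sub, sub_eq_zero] at this
      exact Matrix.ext this
  · rintro h _ ((⟨b, k, l, m, n, i, j, rfl⟩ | ⟨b, i, j, rfl⟩) | ⟨b, k, l, i, j, rfl⟩)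
    all_goals rw [SetLike.mem_coe, RingHom.mem_ker, map_sub, sub_eq_zero]
    · have := (h.isMatrixUnits b).mul k l m n
      rw [← map_mul] at this
      refine congr($this i j).trans ?_
      split_ifs <;> simp
    · have := (h.isMatrixUnits b).one
      rw [← map_sum, ← map_one f.mapMatrix] at this
      exact congr($this i j)
    · have := h.inv b k l
      rw [h3, ← mapMatrix_single f] at this
      exact congr($this i j)

/-- The coordinate ring of `PGL₂[1/2]`. -/
def PGLRing : Type u :=
  MvPolynomial (Bool × (Fin 2 × Fin 2) × (Fin 2 × Fin 2)) ZHalf.{u} ⧸ pglIdeal.{u}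

instance : CommRing PGLRing.{u} := inferInstanceAs (CommRing (_ ⧸ pglIdeal.{u}))

instance : Algebra ZHalf.{u} PGLRing.{u} := inferInstanceAs (Algebra _ (_ ⧸ pglIdeal.{u}))

/-- The quotient map onto the coordinate ring of `PGL₂[1/2]`. -/
def pglMk : MvPolynomial (Bool × (Fin 2 × Fin 2) × (Fin 2 × Fin 2)) ZHalf.{u} →+* PGLRing.{u} :=
  Ideal.Quotient.mk pglIdeal

/-- The images of the matrix units under the universal automorphism and its inverse. -/
def pglUniv (b : Bool) (k l : Fin 2) : Matrix (Fin 2) (Fin 2) PGLRing.{u} :=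
  pglMk.mapMatrix (pglGen b k l)

lemma isAutData_pglUniv : IsAutData pglUniv.{u} :=
  (pglIdeal_le_ker pglMk.{u}).mp (Ideal.mk_ker (I := pglIdeal.{u})).ge

section
variable {R : Type*} [CommRing R]

/-- The homomorphism classifying an automorphism of `M₂(R)`. -/
def pglLift (h2 : IsUnit (2 : R)) (φ : MatAut R) : PGLRing.{u} →+* R :=
  Ideal.Quotient.lift pglIdeal
    (MvPolynomial.eval₂Hom (zHalfHom h2) fun p ↦ autData φ p.1 p.2.1.1 p.2.1.2 p.2.2.1 p.2.2.2) <| by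
    refine (pglIdeal_le_ker _).mpr ?_
    convert! isAutData_autData φ using 4
    ext i j
    simp [pglGen]

lemma pglLift_pglUniv (h2 : IsUnit (2 : R)) (φ : MatAut R) (b : Bool) (k l : Fin 2) :
    (pglLift h2 φ).mapMatrix (pglUniv b k l) = autData φ b k l := by
  ext i j
  change MvPolynomial.eval₂Hom (zHalfHom h2)
    (fun p ↦ autData φ p.1 p.2.1.1 p.2.1.2 p.2.2.1 p.2.2.2) (.X (b, (k, l), (i, j))) = _
  simp

lemma pglRing_hom_ext {f g : PGLRing.{u} →+* R}
    (h : ∀ b k l, f.mapMatrix (pglUniv b k l) = g.mapMatrix (pglUniv b k l)) : f = g := by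
  apply Ideal.Quotient.ringHom_ext
  apply MvPolynomial.ringHom_ext
  · intro r
    exact congr($(Subsingleton.elim
      (f.comp (algebraMap ZHalf.{u} PGLRing.{u})) (g.comp (algebraMap _ _))) r)
  · rintro ⟨b, ⟨k, l⟩, i, j⟩
    exact congr($(h b k l) i j)

end

/-- The scheme `PGL₂[1/2]`. -/
abbrev PGLScheme : Scheme.{u} := Spec (.of PGLRing.{u})

/-- `PGL₂[1/2]` as a scheme over `ℤ[1/2]`. -/
abbrev PGL2 : Over SHalf.{u} :=
  Over.mk (Y := PGLScheme) (Spec.map (CommRingCat.ofHom (algebraMap ZHalf.{u} PGLRing.{u})))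

/-- The functor `T ↦ Aut(M₂(𝒪_T))` on schemes over `ℤ[1/2]`. -/
def autFunctor : (Over SHalf.{u})ᵒᵖ ⥤ GrpCat.{u} where
  obj T := .of (MatAut Γ(T.unop.left, ⊤))
  map f := GrpCat.ofHom (mapAut f.unop.left.appTop.hom)
  map_id T := by
    refine GrpCat.hom_ext (MonoidHom.ext fun φ ↦ ?_)
    exact mapAut_id φ
  map_comp f g := by
    refine GrpCat.hom_ext (MonoidHom.ext fun φ ↦ ?_)
    change mapAut (g.unop ≫ f.unop).left.appTop.hom φ = _
    rw [Over.comp_left, Scheme.Hom.comp_appTop, CommRingCat.hom_comp, mapAut_comp]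
    rfl

/-- The ring homomorphism attached to a point of `PGL₂[1/2]`. -/
def pglPoint {T : Scheme.{u}} (f : T ⟶ PGLScheme.{u}) : PGLRing.{u} →+* Γ(T, ⊤) :=
  ((Scheme.ΓSpecIso (.of PGLRing.{u})).inv ≫ f.appTop).hom

/-- The automorphism of `M₂(𝒪_T)` attached to a `T`-valued point of `PGL₂[1/2]`. -/
def pglAut {T : Scheme.{u}} (f : T ⟶ PGLScheme.{u}) : MatAut Γ(T, ⊤) :=
  (isAutData_pglUniv.map (pglPoint f)).aut

lemma mapAut_pglAut {T T' : Scheme.{u}} (g : T' ⟶ T) (f : T ⟶ PGLScheme.{u}) :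
    mapAut g.appTop.hom (pglAut f) = pglAut (g ≫ f) := by
  have : pglPoint (g ≫ f) = g.appTop.hom.comp (pglPoint f) := by
    simp only [pglPoint, Scheme.Hom.comp_appTop, CommRingCat.hom_comp, RingHom.comp_assoc]
  unfold pglAut
  rw [mapAut_aut _ _ ((isAutData_pglUniv.map (pglPoint f)).map _)]
  simp only [this]
  rfl

lemma pglPoint_toSpec {T : Scheme.{u}} (g : PGLRing.{u} →+* Γ(T, ⊤)) :
    pglPoint (T.toSpecΓ ≫ Spec.map (CommRingCat.ofHom g)) = g := by
  simp [pglPoint]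

lemma pglPoint_injective {T : Scheme.{u}} {f g : T ⟶ PGLScheme.{u}}
    (h : pglPoint f = pglPoint g) : f = g := by
  apply ext_of_isAffine
  rw [← cancel_epi (Scheme.ΓSpecIso (.of PGLRing.{u})).inv]
  exact CommRingCat.hom_ext h

/-- The `T`-valued point of `PGL₂[1/2]` attached to an automorphism of `M₂(𝒪_T)`. -/
def toPGL {T : Scheme.{u}} (h2 : IsUnit (2 : Γ(T, ⊤))) (φ : MatAut Γ(T, ⊤)) : T ⟶ PGLScheme.{u} :=
  T.toSpecΓ ≫ Spec.map (CommRingCat.ofHom (pglLift h2 φ))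

lemma toPGL_pglAut {T : Scheme.{u}} (h2 : IsUnit (2 : Γ(T, ⊤))) (f : T ⟶ PGLScheme.{u}) :
    toPGL h2 (pglAut f) = f := by
  apply pglPoint_injective
  apply pglRing_hom_ext
  intro b k l
  rw [toPGL, pglPoint_toSpec, pglLift_pglUniv, pglAut, autData_aut]

lemma pglAut_toPGL {T : Scheme.{u}} (h2 : IsUnit (2 : Γ(T, ⊤))) (φ : MatAut Γ(T, ⊤)) :
    pglAut (toPGL h2 φ) = φ := by
  refine Eq.trans ?_ (aut_autData φ)
  unfold pglAut
  congr 1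
  funext b k l
  rw [toPGL, pglPoint_toSpec, pglLift_pglUniv]

/-- `PGL₂[1/2]` represents `T ↦ Aut(M₂(𝒪_T))`. -/
def pglRepresentableBy : (autFunctor.{u} ⋙ forget _).RepresentableBy PGL2.{u} where
  homEquiv {T} :=
    { toFun f := pglAut f.left
      invFun φ := Over.homMk (toPGL (isUnit_two_of_over T) φ) (Subsingleton.elim _ _)
      left_inv f := Over.OverMorphism.ext (toPGL_pglAut _ _)
      right_inv φ := pglAut_toPGL _ _ }
  homEquiv_comp f g := (mapAut_pglAut f.left g.left).symm

/-- The group scheme structure of `PGL₂[1/2]`, by composition of automorphisms. -/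
instance : GrpObj PGL2.{u} := GrpObj.ofRepresentableBy _ autFunctor pglRepresentableBy

end PGL

section Action
variable {R : Type*} [CommRing R] {Γ : Type u} [Monoid Γ]

/-- The representation `γ ↦ φ⁻¹(ρ(γ))`; it is `P⁻¹ ρ(γ) P` if `φ` is the conjugation
`X ↦ P X P⁻¹`. -/
def conjRep (ρ : Γ →* Matrix (Fin 2) (Fin 2) R) (φ : MatAut R) :
    Γ →* Matrix (Fin 2) (Fin 2) R :=
  (φ.symm : Matrix (Fin 2) (Fin 2) R →* Matrix (Fin 2) (Fin 2) R).comp ρ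

lemma conjRep_apply (ρ : Γ →* Matrix (Fin 2) (Fin 2) R) (φ : MatAut R) (γ : Γ) :
    conjRep ρ φ γ = φ.symm (ρ γ) := rfl

lemma matAut_apply (φ : MatAut R) (X : Matrix (Fin 2) (Fin 2) R) :
    φ X = ∑ p : Fin 2 × Fin 2, X p.1 p.2 • φ (Matrix.single p.1 p.2 1) := by
  rw [Fintype.sum_prod_type]
  conv_lhs => rw [Matrix.matrix_eq_sum_single X]
  have (i j : Fin 2) : Matrix.single i j (X i j) = X i j • Matrix.single i j 1 := by simp
  simp only [this, map_sum, map_smul]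

lemma trace_matAut (h2 : IsUnit (2 : R)) (φ : MatAut R) (X : Matrix (Fin 2) (Fin 2) R) :
    (φ X).trace = X.trace := by
  have hc (X Y : Matrix (Fin 2) (Fin 2) R) : (φ (X * Y)).trace = (φ (Y * X)).trace := by
    rw [map_mul, Matrix.trace_mul_comm, ← map_mul]
  have h01 : (φ (Matrix.single 0 1 1)).trace = 0 := by
    have := hc (Matrix.single 0 0 1) (Matrix.single 0 1 1)
    simpa using this
  have h10 : (φ (Matrix.single 1 0 1)).trace = 0 := by
    have := hc (Matrix.single 1 1 1) (Matrix.single 1 0 1)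
    simpa using this
  have h11 : (φ (Matrix.single 1 1 1)).trace = (φ (Matrix.single 0 0 1)).trace := by
    have := hc (Matrix.single 1 0 1) (Matrix.single 0 1 1)
    simpa using this
  have h : ∀ X : Matrix (Fin 2) (Fin 2) R,
      (φ X).trace = X.trace * (φ (Matrix.single 0 0 1)).trace := by
    intro X
    rw [matAut_apply φ X]
    simp only [Fintype.sum_prod_type, Fin.sum_univ_two, Matrix.trace_add, Matrix.trace_smul, h01,
      h10, h11, smul_eq_mul, Matrix.trace_fin_two X]
    ring
  have h1 : (φ (Matrix.single 0 0 1)).trace = 1 := by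
    have := h 1
    rw [map_one, Matrix.trace_one] at this
    apply h2.mul_left_cancel
    simpa using this.symm
  rw [h, h1, mul_one]

lemma disc_eq (X : Matrix (Fin 2) (Fin 2) R) : disc X = 2 * (X * X).trace - X.trace ^ 2 := by
  simp [disc, Matrix.trace_fin_two, Matrix.det_fin_two, Matrix.mul_apply, Fin.sum_univ_two]
  ring

lemma disc_matAut (h2 : IsUnit (2 : R)) (φ : MatAut R) (X : Matrix (Fin 2) (Fin 2) R) :
    disc (φ X) = disc X := by
  rw [disc_eq, disc_eq, ← map_mul, trace_matAut h2, trace_matAut h2]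

lemma minor_conjRep (ρ : Γ →* Matrix (Fin 2) (Fin 2) R) (φ : MatAut R)
    (h : ∀ g r, minor ρ g r = 0) (g : Fin 3 → Γ) (r : Fin 3 → Fin 2 × Fin 2) :
    minor (conjRep ρ φ) g r = 0 := by
  have : (Matrix.of fun p q ↦ conjRep ρ φ (g q) (r p).1 (r p).2 : Matrix (Fin 3) (Fin 3) R) =
      fun p ↦ ∑ s : Fin 2 × Fin 2, (φ.symm (Matrix.single s.1 s.2 1) (r p).1 (r p).2) •
        (fun q ↦ ρ (g q) s.1 s.2) := by
    ext p q
    rw [Matrix.of_apply, conjRep_apply, matAut_apply]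
    simp only [Matrix.sum_apply, Finset.sum_apply, Pi.smul_apply, Matrix.smul_apply, smul_eq_mul]
    exact Finset.sum_congr rfl fun _ _ ↦ mul_comm _ _
  unfold minor
  rw [this]
  change Matrix.detRowAlternating.toMultilinearMap _ = 0
  rw [MultilinearMap.map_sum]
  refine Finset.sum_eq_zero fun s _ ↦ ?_
  rw [MultilinearMap.map_smul_univ]
  have : Matrix.detRowAlternating.toMultilinearMap (fun p q ↦ ρ (g q) (s p).1 (s p).2) = 0 := h g s
  rw [this, smul_zero]

lemma coord_matAut (φ : MatAut R) (X : Matrix (Fin 2) (Fin 2) R) (i : Fin 3) :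
    coord (φ X) i = coord X 0 * coord (φ (Matrix.single 0 1 1)) i +
      coord X 1 * coord (φ (Matrix.single 1 0 1)) i +
      coord X 2 * coord (φ (Matrix.single 0 0 1)) i := by
  have h1 : φ (Matrix.single 1 1 1) = 1 - φ (Matrix.single 0 0 1) := by
    rw [← map_one φ, ← map_sub]
    congr 1
    ext i j
    fin_cases i <;> fin_cases j <;> simp [Matrix.single]
  rw [matAut_apply φ X]
  simp only [Fintype.sum_prod_type, Fin.sum_univ_two, h1]
  fin_cases i <;> simp [coord] <;> ring

lemma IsUnipotentRep.conj {T : Scheme.{u}} {ρ : RepOn Γ T} (h : IsUnipotentRep ρ)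
    (φ : MatAut Γ(T, ⊤)) : IsUnipotentRep (conjRep ρ φ) where
  isUnit_two := h.isUnit_two
  minor_eq_zero := minor_conjRep ρ φ h.minor_eq_zero
  disc_eq_zero γ := by rw [conjRep_apply, disc_matAut h.isUnit_two, h.disc_eq_zero]
  iSup_basicOpen := by
    refine top_le_iff.mp (h.iSup_basicOpen.symm.le.trans (iSup_le ?_))
    rintro ⟨γ, i⟩
    have h1 := coord_matAut φ (φ.symm (ρ γ)) i
    rw [φ.apply_symm_apply] at h1
    have h2 (j : Fin 3) : T.basicOpen (coord (φ.symm (ρ γ)) j) ≤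
        ⨆ p : Γ × Fin 3, T.basicOpen (coord (conjRep ρ φ p.1) p.2) :=
      le_iSup (fun p : Γ × Fin 3 ↦ T.basicOpen (coord (conjRep ρ φ p.1) p.2)) (γ, j)
    have h3 (a b : Γ(T, ⊤)) : T.basicOpen (a * b) ≤ T.basicOpen a := by
      rw [Scheme.basicOpen_mul]; exact inf_le_left
    dsimp only
    rw [h1]
    refine (Scheme.basicOpen_add_le _ _ _).trans (sup_le ((Scheme.basicOpen_add_le _ _ _).trans
      (sup_le ?_ ?_)) ?_)
    · exact (h3 _ _).trans (h2 0)
    · exact (h3 _ _).trans (h2 1)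
    · exact (h3 _ _).trans (h2 2)

variable (Γ) in
/-- The right action of `PGL₂[1/2]` on `Rep₂(Γ)_u` by conjugation: `(ρ, φ) ↦ φ⁻¹ ∘ ρ`. -/
def actionU : RepU Γ ⊗ PGL2.{u} ⟶ RepU Γ :=
  Over.homMk (toRepU
    (conjRep (pointRep (T := (RepU Γ ⊗ PGL2.{u}).left) (fst (RepU Γ) PGL2.{u}).left)
      (pglAut (snd (RepU Γ) PGL2.{u}).left))
    ((isUnipotentRep_pointRep _).conj _)) (Subsingleton.elim _ _)

end Action

section SymGrading
open scoped DirectSum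
variable (R M : Type*) [CommRing R] [AddCommGroup M] [Module R M]

/-- The standard grading of the symmetric algebra: the elements of degree `n` are the sums of
products of `n` elements of `M`. -/
def symGrading (n : ℕ) : Submodule R (SymmetricAlgebra R M) :=
  LinearMap.range (SymmetricAlgebra.ι R M) ^ n

instance : SetLike.GradedMonoid (symGrading R M) :=
  inferInstanceAs (SetLike.GradedMonoid
    ((LinearMap.range (SymmetricAlgebra.ι R M) ^ ·) : ℕ → Submodule R (SymmetricAlgebra R M)))

lemma ι_mem_symGrading (m : M) : SymmetricAlgebra.ι R M m ∈ symGrading R M 1 := by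
  simpa only [symGrading, pow_one] using LinearMap.mem_range_self _ m

/-- The canonical map into the component of degree `1`. -/
def symGradingι : M →ₗ[R] ⨁ n, symGrading R M n :=
  DirectSum.lof R ℕ (fun n ↦ symGrading R M n) 1 ∘ₗ
    (SymmetricAlgebra.ι R M).codRestrict _ (ι_mem_symGrading R M)

instance : GradedAlgebra (symGrading R M) :=
  GradedAlgebra.ofAlgHom _ (SymmetricAlgebra.lift (symGradingι R M))
    (by
      refine SymmetricAlgebra.algHom_ext (LinearMap.ext fun m ↦ ?_)
      change DirectSum.coeAlgHom (symGrading R M) (SymmetricAlgebra.lift (symGradingι R M)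
        (SymmetricAlgebra.ι R M m)) = SymmetricAlgebra.ι R M m
      rw [SymmetricAlgebra.lift_ι_apply]
      exact DirectSum.coeAlgHom_of _ _ _)
    fun i x ↦ by
      obtain ⟨x, hx⟩ := x
      dsimp only [Subtype.coe_mk, DirectSum.lof_eq_of]
      induction hx using Submodule.pow_induction_on_left' with
      | algebraMap r =>
        rw [AlgHom.commutes, DirectSum.algebraMap_apply]; rfl
      | add x y i hx hy ihx ihy =>
        rw [map_add, ihx, ihy, ← map_add]
        rfl
      | mem_mul m hm i x hx ih =>
        obtain ⟨m, rfl⟩ := hm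
        rw [map_mul, ih, SymmetricAlgebra.lift_ι_apply]
        exact (DirectSum.of_mul_of _ _).trans
          (DirectSum.of_eq_of_gradedMonoid_eq (Sigma.subtype_ext (add_comm _ _) rfl))

end SymGrading

section ProjPoint

variable {A : Type u} [CommRing A] {σ : Type*} [SetLike σ A] [AddSubgroupClass σ A]
  (𝒜 : ℕ → σ) [GradedRing 𝒜]

/-- The homomorphism `A_(t) → R` induced by a homomorphism `A → R` which maps `t` to a unit. -/
def awayLift {R : Type*} [CommRing R] (f : A →+* R) (t : A) (h : IsUnit (f t)) :
    HomogeneousLocalization.Away 𝒜 t →+* R :=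
  (IsLocalization.Away.lift (S := Localization.Away t) t h).comp
    (algebraMap (HomogeneousLocalization.Away 𝒜 t) (Localization.Away t))

lemma awayLift_mul {R : Type*} [CommRing R] (f : A →+* R) {t : A} (h : IsUnit (f t))
    (z : HomogeneousLocalization.Away 𝒜 t) (n : ℕ) (x : A)
    (hz : z.val * algebraMap A (Localization.Away t) (t ^ n) =
      algebraMap A (Localization.Away t) x) :
    awayLift 𝒜 f t h z * f t ^ n = f x := by
  have h2 := congr(IsLocalization.Away.lift (S := Localization.Away t) t h $hz)
  rw [map_mul, IsLocalization.Away.lift_eq, IsLocalization.Away.lift_eq, map_pow] at h2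
  exact h2

lemma awayLift_mk {R : Type*} [CommRing R] (f : A →+* R) {t : A} (h : IsUnit (f t))
    {d : ℕ} (ht : t ∈ 𝒜 d) (n : ℕ) (x : A) (hx : x ∈ 𝒜 (n • d)) :
    awayLift 𝒜 f t h (HomogeneousLocalization.Away.mk 𝒜 ht n x hx) * f t ^ n = f x := by
  apply awayLift_mul
  rw [HomogeneousLocalization.Away.val_mk, Localization.mk_eq_mk']
  exact IsLocalization.mk'_spec (Localization.Away t) x ⟨t ^ n, _⟩

/-- The morphism `X → D₊(t) ⊆ Proj A` induced by a homomorphism from `A` to the global functions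
on `X` which maps `t` to a unit. -/
def projPoint {X : Scheme.{u}} (f : A →+* Γ(X, ⊤)) {t : A} {d : ℕ} (ht : t ∈ 𝒜 d) (hd : 0 < d)
    (h : IsUnit (f t)) : X ⟶ Proj 𝒜 :=
  X.toSpecΓ ≫ Spec.map (CommRingCat.ofHom (awayLift 𝒜 f t h)) ≫ Proj.awayι 𝒜 t ht hd

lemma projPoint_mul {X : Scheme.{u}} (f : A →+* Γ(X, ⊤)) {s t : A} {d e : ℕ} (ht : t ∈ 𝒜 d)
    (hd : 0 < d) (hs : s ∈ 𝒜 e) (h : IsUnit (f t)) (h' : IsUnit (f (t * s))) :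
    projPoint 𝒜 f (SetLike.mul_mem_graded ht hs) (hd.trans_le (d.le_add_right e)) h' =
      projPoint 𝒜 f ht hd h := by
  have key : (awayLift 𝒜 f (t * s) h').comp (HomogeneousLocalization.awayMap 𝒜 hs rfl) =
      awayLift 𝒜 f t h := by
    ext z
    obtain ⟨n, x, hx, rfl⟩ := HomogeneousLocalization.Away.mk_surjective 𝒜 ht z
    apply (h'.pow n).mul_right_cancel
    rw [RingHom.comp_apply, awayLift_mul 𝒜 f h' _ n (x * s ^ n), map_mul, map_mul, mul_pow,
      ← mul_assoc, awayLift_mk, map_pow]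
    erw [HomogeneousLocalization.val_awayMap_mk]
    rw [Localization.mk_eq_mk']
    exact IsLocalization.mk'_spec (Localization.Away (t * s)) _ ⟨(t * s) ^ n, _⟩
  unfold projPoint
  rw [← key, CommRingCat.ofHom_comp, Spec.map_comp, Category.assoc,
    Proj.SpecMap_awayMap_awayι 𝒜 ht hd hs rfl]

lemma projPoint_scale {X : Scheme.{u}} (f g : A →+* Γ(X, ⊤)) (v : Γ(X, ⊤))
    (hfg : ∀ n, ∀ x ∈ 𝒜 n, g x = v ^ n * f x) {t : A} {d : ℕ} (ht : t ∈ 𝒜 d)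
    (hd : 0 < d) (hf : IsUnit (f t)) (hg : IsUnit (g t)) :
    projPoint 𝒜 f ht hd hf = projPoint 𝒜 g ht hd hg := by
  have key : awayLift 𝒜 f t hf = awayLift 𝒜 g t hg := by
    ext z
    obtain ⟨n, x, hx, rfl⟩ := HomogeneousLocalization.Away.mk_surjective 𝒜 ht z
    apply (hg.pow n).mul_right_cancel
    rw [awayLift_mk, hfg _ _ hx, hfg _ _ ht, mul_pow, mul_left_comm, awayLift_mk, ← pow_mul,
      smul_eq_mul, mul_comm n d]
  unfold projPoint
  rw [key]

lemma comp_projPoint {X Y : Scheme.{u}} (p : Y ⟶ X) (f : A →+* Γ(X, ⊤)) {t : A} {d : ℕ}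
    (ht : t ∈ 𝒜 d) (hd : 0 < d) (h : IsUnit (f t)) :
    p ≫ projPoint 𝒜 f ht hd h =
      projPoint 𝒜 (p.appTop.hom.comp f) ht hd (h.map p.appTop.hom) := by
  have key : awayLift 𝒜 (p.appTop.hom.comp f) t (h.map p.appTop.hom) =
      p.appTop.hom.comp (awayLift 𝒜 f t h) := by
    ext z
    obtain ⟨n, x, hx, rfl⟩ := HomogeneousLocalization.Away.mk_surjective 𝒜 ht z
    apply ((h.map p.appTop.hom).pow n).mul_right_cancel
    refine (awayLift_mk 𝒜 (p.appTop.hom.comp f) (h.map p.appTop.hom) ht n x hx).trans ?_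
    rw [RingHom.comp_apply, RingHom.comp_apply, ← map_pow, ← map_mul, awayLift_mk]
  unfold projPoint
  rw [key, Scheme.toSpecΓ_naturality_assoc, CommRingCat.ofHom_comp, Spec.map_comp, Category.assoc]
  rfl

end ProjPoint

section Omega
variable (Γ : Type u) [Monoid Γ]

/-- The universal character `χ_Γ : Γ → A₁(Γ)[1/2]`. -/
def univChar (γ : Γ) : RepRing 1 Γ := univRep 1 Γ γ 0 0

/-- The submodule of relations `d(γδ) = χ(γ) dδ + χ(δ) dγ`. -/
def omegaRel : Submodule (RepRing 1 Γ) (Γ →₀ RepRing 1 Γ) :=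
  .span _ {x | ∃ γ δ, x = univChar Γ γ • Finsupp.single δ 1 + univChar Γ δ • Finsupp.single γ 1 -
    Finsupp.single (γ * δ) 1}

/-- The module `Ω_Γ` representing the derivations of `Γ` with respect to `χ_Γ`. -/
def Omega : Type u := (Γ →₀ RepRing 1 Γ) ⧸ omegaRel Γ

instance : AddCommGroup (Omega Γ) := inferInstanceAs (AddCommGroup (_ ⧸ omegaRel Γ))

instance : Module (RepRing 1 Γ) (Omega Γ) := inferInstanceAs (Module _ (_ ⧸ omegaRel Γ))

variable {Γ}

/-- The element `dγ` of `Ω_Γ`. -/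
def omegaD (γ : Γ) : Omega Γ := (omegaRel Γ).mkQ (Finsupp.single γ 1)

/-- The element `dγ` of the symmetric algebra `S(Ω_Γ)`. -/
def symD (γ : Γ) : SymmetricAlgebra (RepRing 1 Γ) (Omega Γ) :=
  SymmetricAlgebra.ι (RepRing 1 Γ) (Omega Γ) (omegaD γ)

lemma symD_mem (γ : Γ) : symD γ ∈ symGrading (RepRing 1 Γ) (Omega Γ) 1 := ι_mem_symGrading _ _ _

variable (Γ) in
/-- The scheme `Ch₂(Γ)_u = Proj S(Ω_Γ)`. -/
abbrev ChUScheme : Scheme.{u} := Proj (symGrading (RepRing 1 Γ) (Omega Γ))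

variable (Γ) in
/-- `Ch₂(Γ)_u` as a scheme over `ℤ[1/2]`. -/
abbrev ChU : Over SHalf.{u} :=
  Over.mk (Y := ChUScheme Γ) (Proj.toSpecZero _ ≫
    Spec.map (CommRingCat.ofHom (algebraMap (RepRing 1 Γ) (symGrading (RepRing 1 Γ) (Omega Γ) 0))) ≫
    Spec.map (CommRingCat.ofHom (algebraMap ZHalf.{u} (RepRing 1 Γ))))

variable {R : Type u} [CommRing R]

/-- The homomorphism `A₁(Γ)[1/2] → R` classifying a character of `Γ` with values in `R`. -/
def charHom (h2 : IsUnit (2 : R)) (r : Γ →* R) : RepRing 1 Γ →+* R :=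
  repLift h2 ((Matrix.scalar (Fin 1)).toMonoidHom.comp r)

lemma charHom_univChar (h2 : IsUnit (2 : R)) (r : Γ →* R) (γ : Γ) :
    charHom h2 r (univChar Γ γ) = r γ := by
  have := congr($(repLift_univRep h2 ((Matrix.scalar (Fin 1)).toMonoidHom.comp r) γ) 0 0)
  simpa [charHom, univChar] using this

/-- The homomorphism `S(Ω_Γ) → R` attached to a character `r` and a derivation `a` with respect
to `r`: it extends the one attached to `r` and maps `dγ` to `a γ`. -/
def chHom (h2 : IsUnit (2 : R)) (r : Γ →* R) (a : Γ → R)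
    (ha : ∀ γ δ, a (γ * δ) = r γ * a δ + a γ * r δ) :
    SymmetricAlgebra (RepRing 1 Γ) (Omega Γ) →+* R :=
  letI := (charHom h2 r).toAlgebra
  (SymmetricAlgebra.lift ((omegaRel Γ).liftQ (Finsupp.linearCombination (RepRing 1 Γ) a) <| by
    refine Submodule.span_le.mpr ?_
    rintro _ ⟨γ, δ, rfl⟩
    rw [SetLike.mem_coe, LinearMap.mem_ker]
    simp only [map_sub, map_add, map_smul, Finsupp.linearCombination_single,
      Algebra.smul_def, RingHom.algebraMap_toAlgebra, charHom_univChar, ha]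
    ring) : SymmetricAlgebra (RepRing 1 Γ) (Omega Γ) →ₐ[RepRing 1 Γ] R).toRingHom

lemma chHom_symD (h2 : IsUnit (2 : R)) (r : Γ →* R) (a : Γ → R)
    (ha : ∀ γ δ, a (γ * δ) = r γ * a δ + a γ * r δ) (γ : Γ) :
    chHom h2 r a ha (symD γ) = a γ := by
  let := (charHom h2 r).toAlgebra
  refine (SymmetricAlgebra.lift_ι_apply _ _).trans ?_
  refine ((omegaRel Γ).liftQ_apply _ _).trans ?_
  simp

lemma chHom_algebraMap (h2 : IsUnit (2 : R)) (r : Γ →* R) (a : Γ → R)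
    (ha : ∀ γ δ, a (γ * δ) = r γ * a δ + a γ * r δ) (x : RepRing 1 Γ) :
    chHom h2 r a ha (algebraMap _ _ x) = charHom h2 r x :=
  let := (charHom h2 r).toAlgebra
  AlgHom.commutes _ _

lemma repRing_hom_ext {n : ℕ} {R : Type*} [CommRing R] {f g : RepRing n Γ →+* R}
    (h : ∀ γ, f.mapMatrix (univRep n Γ γ) = g.mapMatrix (univRep n Γ γ)) : f = g := by
  apply Ideal.Quotient.ringHom_ext
  apply MvPolynomial.ringHom_ext
  · intro r
    exact congr($(Subsingleton.elim
      (f.comp (algebraMap ZHalf.{u} (RepRing n Γ))) (g.comp (algebraMap _ _))) r)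
  · rintro ⟨γ, i, j⟩
    exact congr($(h γ) i j)

lemma omega_induction {p : Omega Γ → Prop} (x : Omega Γ) (h0 : p 0)
    (hadd : ∀ x y, p x → p y → p (x + y)) (hsmul : ∀ (c : RepRing 1 Γ) γ, p (c • omegaD γ)) :
    p x := by
  obtain ⟨x, rfl⟩ := (omegaRel Γ).mkQ_surjective x
  induction x using Finsupp.induction_linear with
  | zero => rw [map_zero]; exact h0
  | add x y hx hy => rw [map_add]; exact hadd _ _ hx hy
  | single γ c =>
    have : Finsupp.single γ c = c • Finsupp.single γ (1 : RepRing 1 Γ) := by simp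
    rw [this, map_smul]
    exact hsmul c γ

/-- Two homomorphisms whose derivations differ by a factor `v` differ by `v ^ n` in degree `n`. -/
lemma chHom_scale {f g : SymmetricAlgebra (RepRing 1 Γ) (Omega Γ) →+* R} (v : R)
    (h0 : ∀ γ, f (algebraMap _ _ (univChar Γ γ)) = g (algebraMap _ _ (univChar Γ γ)))
    (h1 : ∀ γ, g (symD γ) = v * f (symD γ)) (n : ℕ)
    (x : SymmetricAlgebra (RepRing 1 Γ) (Omega Γ))
    (hx : x ∈ symGrading (RepRing 1 Γ) (Omega Γ) n) : g x = v ^ n * f x := by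
  have h0' : f.comp (algebraMap (RepRing 1 Γ) _) = g.comp (algebraMap (RepRing 1 Γ) _) := by
    apply repRing_hom_ext
    intro γ
    ext i j
    fin_cases i; fin_cases j
    exact h0 γ
  have h0'' (c : RepRing 1 Γ) : f (algebraMap _ _ c) = g (algebraMap _ _ c) := congr($h0' c)
  unfold symGrading at hx
  induction hx using Submodule.pow_induction_on_left' with
  | algebraMap r => simp [h0'']
  | add x y i hx hy ihx ihy => rw [map_add, ihx, ihy, map_add, mul_add]
  | mem_mul m hm i x hx ih =>
    obtain ⟨m, rfl⟩ := hm
    have : g (SymmetricAlgebra.ι _ _ m) = v * f (SymmetricAlgebra.ι _ _ m) := by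
      induction m using omega_induction with
      | h0 => simp
      | hadd x y hx hy => rw [map_add, map_add, hx, hy, map_add, mul_add]
      | hsmul c γ =>
        have h1' : g (SymmetricAlgebra.ι _ _ (omegaD γ)) =
          v * f (SymmetricAlgebra.ι _ _ (omegaD γ)) := h1 γ
        rw [map_smul, Algebra.smul_def, map_mul, map_mul, h1', h0'']
        ring
    rw [map_mul, map_mul, ih, this, Nat.succ_eq_add_one, pow_succ]
    ring

end Omega

section Derivation
variable {Γ : Type u} [Monoid Γ] {R : Type u} [CommRing R]

/-- `r(X) = tr(X)/2`. -/
def halfTrace (h2 : IsUnit (2 : R)) (X : Matrix (Fin 2) (Fin 2) R) : R :=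
  ↑h2.unit⁻¹ * X.trace

lemma two_mul_halfTrace (h2 : IsUnit (2 : R)) (X : Matrix (Fin 2) (Fin 2) R) :
    2 * halfTrace h2 X = X.trace := by
  rw [halfTrace, ← mul_assoc, IsUnit.mul_val_inv, one_mul]

lemma coord_mul_comm {ρ : Γ →* Matrix (Fin 2) (Fin 2) R} (hm : ∀ g r, minor ρ g r = 0)
    (α γ : Γ) (i j : Fin 3) :
    coord (ρ α) i * coord (ρ γ) j = coord (ρ α) j * coord (ρ γ) i := by
  have h1 := hm ![1, α, γ] ![(0, 0), (0, 1), (1, 0)]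
  have h2 := hm ![1, α, γ] ![(0, 0), (0, 1), (1, 1)]
  have h3 := hm ![1, α, γ] ![(0, 0), (1, 0), (1, 1)]
  simp [minor, Matrix.det_fin_three] at h1 h2 h3
  fin_cases i <;> fin_cases j <;> simp [coord]
  all_goals first | ring1 | linear_combination h1 | linear_combination -h1 |
    linear_combination h2 | linear_combination -h2 | linear_combination h3 | linear_combination -h3

lemma coord_eq {ρ : Γ →* Matrix (Fin 2) (Fin 2) R}
    (hm : ∀ g r, minor ρ g r = 0) {α : Γ} {i : Fin 3} (hu : IsUnit (coord (ρ α) i)) (γ : Γ)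
    (j : Fin 3) : coord (ρ γ) j = coord (ρ γ) i * ↑hu.unit⁻¹ * coord (ρ α) j := by
  apply hu.mul_left_cancel
  rw [coord_mul_comm hm α γ i j]
  linear_combination (-(coord (ρ γ) i * coord (ρ α) j)) * hu.mul_val_inv

lemma matrix_ext_of_coord (h2 : IsUnit (2 : R)) {X Y : Matrix (Fin 2) (Fin 2) R}
    (ht : X.trace = Y.trace) (hc : ∀ j, coord X j = coord Y j) : X = Y := by
  have h0 := hc 0
  have h1 := hc 1
  have h3 := hc 2
  simp only [coord, Matrix.cons_val] at h0 h1 h3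
  rw [Matrix.trace_fin_two, Matrix.trace_fin_two] at ht
  have h00 : X 0 0 = Y 0 0 := h2.mul_left_cancel (by linear_combination ht + h3)
  have h11 : X 1 1 = Y 1 1 := h2.mul_left_cancel (by linear_combination ht - h3)
  ext i j
  fin_cases i <;> fin_cases j <;> assumption

/-- `η(X) = X - tr(X)/2`. -/
def eta (h2 : IsUnit (2 : R)) (X : Matrix (Fin 2) (Fin 2) R) : Matrix (Fin 2) (Fin 2) R :=
  X - halfTrace h2 X • 1

lemma trace_eta (h2 : IsUnit (2 : R)) (X : Matrix (Fin 2) (Fin 2) R) : (eta h2 X).trace = 0 := by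
  rw [eta, Matrix.trace_sub, Matrix.trace_smul, Matrix.trace_one, ← two_mul_halfTrace h2 X]
  simp [mul_comm]

lemma coord_smul_one_add (c d : R) (X : Matrix (Fin 2) (Fin 2) R) (j : Fin 3) :
    coord (c • 1 + d • X) j = d * coord X j := by
  fin_cases j <;> simp [coord]; ring

lemma coord_eta (h2 : IsUnit (2 : R)) (X : Matrix (Fin 2) (Fin 2) R) (j : Fin 3) :
    coord (eta h2 X) j = coord X j := by
  fin_cases j <;> simp [coord, eta]

lemma eta_mul_eta (h2 : IsUnit (2 : R)) {X : Matrix (Fin 2) (Fin 2) R} (h : disc X = 0) :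
    eta h2 X * eta h2 X = 0 := by
  have ht : halfTrace h2 X * 2 = X 0 0 + X 1 1 := by
    rw [mul_comm, two_mul_halfTrace, Matrix.trace_fin_two]
  rw [disc, Matrix.trace_fin_two, Matrix.det_fin_two, ← ht] at h
  have h4 : IsUnit (4 : R) := by
    have := h2.mul h2
    norm_num at this
    exact this
  ext i j
  apply h4.mul_left_cancel
  have hX : X 1 1 = halfTrace h2 X * 2 - X 0 0 := by rw [ht]; ring
  rw [hX] at h
  fin_cases i <;> fin_cases j <;> simp [eta, Matrix.mul_apply, Fin.sum_univ_two, hX] <;>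
    first | ring1 | linear_combination h

/-- `ρ(γ) = r(γ) + a_α(γ) η(ρ(α))`, where `a_α(γ) = coord (ρ γ) i / coord (ρ α) i`. -/
lemma rep_eq {ρ : Γ →* Matrix (Fin 2) (Fin 2) R} (h2 : IsUnit (2 : R))
    (hm : ∀ g r, minor ρ g r = 0) {α : Γ} {i : Fin 3} (hu : IsUnit (coord (ρ α) i)) (γ : Γ) :
    ρ γ = halfTrace h2 (ρ γ) • 1 + (coord (ρ γ) i * ↑hu.unit⁻¹) • eta h2 (ρ α) := by
  apply matrix_ext_of_coord h2
  · rw [Matrix.trace_add, Matrix.trace_smul, Matrix.trace_smul, trace_eta, Matrix.trace_one,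
      ← two_mul_halfTrace h2 (ρ γ)]
    simp [mul_comm]
  · intro j
    rw [coord_smul_one_add, coord_eta, ← coord_eq hm]

lemma rep_mul_eq {ρ : Γ →* Matrix (Fin 2) (Fin 2) R} (h2 : IsUnit (2 : R))
    (hm : ∀ g r, minor ρ g r = 0) (hd : ∀ γ, disc (ρ γ) = 0) {α : Γ} {i : Fin 3}
    (hu : IsUnit (coord (ρ α) i)) (γ δ : Γ) :
    ρ (γ * δ) = (halfTrace h2 (ρ γ) * halfTrace h2 (ρ δ)) • 1 +
      (halfTrace h2 (ρ γ) * (coord (ρ δ) i * ↑hu.unit⁻¹) +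
        (coord (ρ γ) i * ↑hu.unit⁻¹) * halfTrace h2 (ρ δ)) • eta h2 (ρ α) := by
  conv_lhs => rw [map_mul, rep_eq h2 hm hu γ, rep_eq h2 hm hu δ]
  simp only [add_mul, mul_add, smul_mul_smul_comm, eta_mul_eta h2 (hd α), mul_one, one_mul,
    smul_zero, add_zero, add_smul]
  abel

/-- The character `r` of a representation with unipotent mold. -/
def charOf (ρ : Γ →* Matrix (Fin 2) (Fin 2) R) (h2 : IsUnit (2 : R))
    (hm : ∀ g r, minor ρ g r = 0) (hd : ∀ γ, disc (ρ γ) = 0) {α : Γ} {i : Fin 3}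
    (hu : IsUnit (coord (ρ α) i)) : Γ →* R where
  toFun γ := halfTrace h2 (ρ γ)
  map_one' := by
    apply h2.mul_left_cancel
    rw [two_mul_halfTrace, map_one, Matrix.trace_one]
    simp
  map_mul' γ δ := by
    apply h2.mul_left_cancel
    rw [two_mul_halfTrace, rep_mul_eq h2 hm hd hu, Matrix.trace_add, Matrix.trace_smul,
      Matrix.trace_smul, trace_eta, Matrix.trace_one]
    simp [mul_comm]

/-- The function `a_α` with `η(ρ(γ)) = a_α(γ) η(ρ(α))`. -/
def derivOf (ρ : Γ →* Matrix (Fin 2) (Fin 2) R) {α : Γ} {i : Fin 3}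
    (hu : IsUnit (coord (ρ α) i)) (γ : Γ) : R := coord (ρ γ) i * ↑hu.unit⁻¹

lemma derivOf_self (ρ : Γ →* Matrix (Fin 2) (Fin 2) R) {α : Γ} {i : Fin 3}
    (hu : IsUnit (coord (ρ α) i)) : derivOf ρ hu α = 1 := hu.mul_val_inv

lemma eta_eq_derivOf_smul {ρ : Γ →* Matrix (Fin 2) (Fin 2) R} (h2 : IsUnit (2 : R))
    (hm : ∀ g r, minor ρ g r = 0) {α : Γ} {i : Fin 3} (hu : IsUnit (coord (ρ α) i)) (γ : Γ) :
    eta h2 (ρ γ) = derivOf ρ hu γ • eta h2 (ρ α) := by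
  conv_lhs => rw [eta]
  nth_rw 1 [rep_eq h2 hm hu γ]
  rw [add_sub_cancel_left, derivOf]

lemma derivOf_mul (ρ : Γ →* Matrix (Fin 2) (Fin 2) R) (h2 : IsUnit (2 : R))
    (hm : ∀ g r, minor ρ g r = 0) (hd : ∀ γ, disc (ρ γ) = 0) {α : Γ} {i : Fin 3}
    (hu : IsUnit (coord (ρ α) i)) (γ δ : Γ) :
    derivOf ρ hu (γ * δ) = charOf ρ h2 hm hd hu γ * derivOf ρ hu δ +
      derivOf ρ hu γ * charOf ρ h2 hm hd hu δ := by
  rw [derivOf, rep_mul_eq h2 hm hd hu, coord_smul_one_add, coord_eta, mul_assoc, hu.mul_val_inv,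
    mul_one]
  rfl

/-- The homomorphism `S(Ω_Γ) → R` given by the character `r = tr(ρ)/2` and the derivation `a_α`
with `η(ρ(γ)) = a_α(γ) η(ρ(α))`. -/
def unipHom (ρ : Γ →* Matrix (Fin 2) (Fin 2) R) (h2 : IsUnit (2 : R))
    (hm : ∀ g r, minor ρ g r = 0) (hd : ∀ γ, disc (ρ γ) = 0) {α : Γ} {i : Fin 3}
    (hu : IsUnit (coord (ρ α) i)) : SymmetricAlgebra (RepRing 1 Γ) (Omega Γ) →+* R :=
  chHom h2 (charOf ρ h2 hm hd hu) (derivOf ρ hu) (derivOf_mul ρ h2 hm hd hu)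

lemma unipHom_scale (ρ : Γ →* Matrix (Fin 2) (Fin 2) R) (h2 : IsUnit (2 : R))
    (hm : ∀ g r, minor ρ g r = 0) (hd : ∀ γ, disc (ρ γ) = 0) {α β : Γ} {i j : Fin 3}
    (hu : IsUnit (coord (ρ α) i)) (hv : IsUnit (coord (ρ β) j)) (n : ℕ)
    (x : SymmetricAlgebra (RepRing 1 Γ) (Omega Γ))
    (hx : x ∈ symGrading (RepRing 1 Γ) (Omega Γ) n) :
    unipHom ρ h2 hm hd hv x = derivOf ρ hv α ^ n * unipHom ρ h2 hm hd hu x := by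
  refine chHom_scale _ (fun γ ↦ ?_) (fun γ ↦ ?_) n x hx
  · rw [unipHom, unipHom, chHom_algebraMap, chHom_algebraMap, charHom_univChar, charHom_univChar]
    rfl
  · rw [unipHom, unipHom, chHom_symD, chHom_symD, derivOf, derivOf, derivOf]
    rw [coord_eq hm hu γ j]
    ring

lemma isUnit_unipHom (ρ : Γ →* Matrix (Fin 2) (Fin 2) R) (h2 : IsUnit (2 : R))
    (hm : ∀ g r, minor ρ g r = 0) (hd : ∀ γ, disc (ρ γ) = 0) {α : Γ} {i : Fin 3}
    (hu : IsUnit (coord (ρ α) i)) : IsUnit (unipHom ρ h2 hm hd hu (symD α)) := by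
  rw [unipHom, chHom_symD, derivOf_self]
  exact isUnit_one

end Derivation

section Quotient
variable {Γ : Type u} [Monoid Γ]

/-- The morphism `X → Ch₂(Γ)_u` given on global functions by `unipHom`, for a representation `ρ`
such that `ρ(α)` is nowhere scalar on `X`. Its image lies in `D₊(dα)`. -/
def chPoint {X : Scheme.{u}} (ρ : RepOn Γ X) (h2 : IsUnit (2 : Γ(X, ⊤)))
    (hm : ∀ g r, minor ρ g r = 0) (hd : ∀ γ, disc (ρ γ) = 0) {α : Γ} {i : Fin 3}
    (hu : IsUnit (coord (ρ α) i)) : X ⟶ ChUScheme Γ :=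
  projPoint (symGrading (RepRing 1 Γ) (Omega Γ)) (unipHom ρ h2 hm hd hu) (symD_mem α) one_pos
    (isUnit_unipHom ρ h2 hm hd hu)

lemma chPoint_eq {X : Scheme.{u}} (ρ : RepOn Γ X) (h2 : IsUnit (2 : Γ(X, ⊤)))
    (hm : ∀ g r, minor ρ g r = 0) (hd : ∀ γ, disc (ρ γ) = 0) {α β : Γ} {i j : Fin 3}
    (hu : IsUnit (coord (ρ α) i)) (hv : IsUnit (coord (ρ β) j)) :
    chPoint ρ h2 hm hd hu = chPoint ρ h2 hm hd hv := by
  have h1 : IsUnit (unipHom ρ h2 hm hd hu (symD β)) := by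
    refine isUnit_of_mul_isUnit_right (x := derivOf ρ hv α ^ 1) ?_
    rw [← unipHom_scale ρ h2 hm hd hu hv 1 _ (symD_mem β)]
    exact isUnit_unipHom ρ h2 hm hd hv
  have h1' : IsUnit (unipHom ρ h2 hm hd hv (symD α)) := by
    refine isUnit_of_mul_isUnit_right (x := derivOf ρ hu β ^ 1) ?_
    rw [← unipHom_scale ρ h2 hm hd hv hu 1 _ (symD_mem α)]
    exact isUnit_unipHom ρ h2 hm hd hu
  have h3 : IsUnit (unipHom ρ h2 hm hd hu (symD α * symD β)) := by
    rw [map_mul]; exact (isUnit_unipHom ρ h2 hm hd hu).mul h1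
  have h3' : IsUnit (unipHom ρ h2 hm hd hv (symD β * symD α)) := by
    rw [map_mul]; exact (isUnit_unipHom ρ h2 hm hd hv).mul h1'
  have h4 : IsUnit (unipHom ρ h2 hm hd hv (symD α * symD β)) := by rwa [mul_comm]
  unfold chPoint
  rw [← projPoint_mul _ _ (symD_mem α) one_pos (symD_mem β) _ h3,
    ← projPoint_mul _ _ (symD_mem β) one_pos (symD_mem α) _ h3',
    projPoint_scale _ _ _ _ (unipHom_scale ρ h2 hm hd hu hv) _ _ h3 h4]
  congr 1
  exact mul_comm _ _

lemma comp_chPoint {X Y : Scheme.{u}} (p : Y ⟶ X) {ρ : RepOn Γ X} (h2 : IsUnit (2 : Γ(X, ⊤)))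
    (hm : ∀ g r, minor ρ g r = 0) (hd : ∀ γ, disc (ρ γ) = 0) {α : Γ} {i : Fin 3}
    (hu : IsUnit (coord (ρ α) i)) {ρ' : RepOn Γ Y} (hρ : mapRep p.appTop.hom ρ = ρ')
    (h2' : IsUnit (2 : Γ(Y, ⊤))) (hm' : ∀ g r, minor ρ' g r = 0) (hd' : ∀ γ, disc (ρ' γ) = 0)
    (hu' : IsUnit (coord (ρ' α) i)) :
    p ≫ chPoint ρ h2 hm hd hu = chPoint ρ' h2' hm' hd' hu' := by
  subst hρ
  have hc (γ : Γ) : coord (mapRep p.appTop.hom ρ γ) i = p.appTop.hom (coord (ρ γ) i) :=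
    map_coord p.appTop.hom (ρ γ) i
  unfold chPoint
  rw [comp_projPoint]
  refine projPoint_scale _ _ _ 1 (fun n x hx ↦ chHom_scale 1 (fun γ ↦ ?_) (fun γ ↦ ?_) n x hx) _ _ _ _
  · rw [RingHom.comp_apply, unipHom, unipHom, chHom_algebraMap, chHom_algebraMap,
      charHom_univChar, charHom_univChar]
    apply h2'.mul_left_cancel
    rw [← map_ofNat p.appTop.hom 2, ← map_mul, map_ofNat]
    change p.appTop.hom (2 * halfTrace h2 _) = 2 * halfTrace h2' _
    rw [two_mul_halfTrace, two_mul_halfTrace]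
    simp [mapRep, Matrix.trace_fin_two]
  · rw [RingHom.comp_apply, unipHom, unipHom, chHom_symD, chHom_symD, one_mul]
    apply hu'.mul_right_cancel
    rw [derivOf, derivOf, mul_assoc, hu'.val_inv_mul, mul_one, hc, hc, ← map_mul, mul_assoc,
      hu.val_inv_mul, mul_one]

lemma mapRep_disc {X Y : Scheme.{u}} (p : Y ⟶ X) {ρ : RepOn Γ X}
    (hd : ∀ γ, disc (ρ γ) = 0) (γ : Γ) : disc (mapRep p.appTop.hom ρ γ) = 0 :=
  (map_disc p.appTop.hom (ρ γ)).trans (by rw [hd, map_zero])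

lemma mapRep_minor {X Y : Scheme.{u}} (p : Y ⟶ X) {ρ : RepOn Γ X}
    (hm : ∀ g r, minor ρ g r = 0) (g : Fin 3 → Γ) (r : Fin 3 → Fin 2 × Fin 2) :
    minor (mapRep p.appTop.hom ρ) g r = 0 := by
  rw [map_minor, hm, map_zero]

lemma isUnit_coord_basicOpen {T : Scheme.{u}} (ρ : RepOn Γ T) (p : Γ × Fin 3) :
    IsUnit (coord (mapRep (T.basicOpen (coord (ρ p.1) p.2)).ι.appTop.hom ρ p.1) p.2) := by
  have h : coord (mapRep (T.basicOpen (coord (ρ p.1) p.2)).ι.appTop.hom ρ p.1) p.2 =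
    (T.basicOpen (coord (ρ p.1) p.2)).ι.appTop.hom (coord (ρ p.1) p.2) := map_coord _ _ _
  rw [h]
  refine RingedSpace.isUnit_of_isUnit_germ _ _ _ fun x hx ↦ ?_
  rw [← RingedSpace.mem_basicOpen]
  have h1 := Scheme.preimage_basicOpen_top (T.basicOpen (coord (ρ p.1) p.2)).ι (coord (ρ p.1) p.2)
  rw [Scheme.Opens.ι_preimage_self] at h1
  exact h1.le hx

lemma mapRep_mapRep {R₁ R₂ R₃ : Type*} [CommRing R₁] [CommRing R₂] [CommRing R₃] (g : R₂ →+* R₃)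
    (f : R₁ →+* R₂) (ρ : Γ →* Matrix (Fin 2) (Fin 2) R₁) :
    mapRep g (mapRep f ρ) = mapRep (g.comp f) ρ := rfl

lemma isUnit_two_map {X Y : Scheme.{u}} (p : Y ⟶ X) (h : IsUnit (2 : Γ(X, ⊤))) :
    IsUnit (2 : Γ(Y, ⊤)) := by
  have := h.map p.appTop.hom
  rwa [map_ofNat] at this

/-- The morphism `T → Ch₂(Γ)_u` attached to a representation on `T` with unipotent mold, glued from
the morphisms `chPoint` on the open subsets where some `ρ(α)` is nowhere scalar. -/
def toChU {T : Scheme.{u}} (ρ : RepOn Γ T) (h : IsUnipotentRep ρ) : T ⟶ ChUScheme Γ :=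
  (T.openCoverOfIsOpenCover (fun p : Γ × Fin 3 ↦ T.basicOpen (coord (ρ p.1) p.2))
    h.iSup_basicOpen).glueMorphisms
    (fun p ↦ chPoint (mapRep (T.basicOpen (coord (ρ p.1) p.2)).ι.appTop.hom ρ)
      (isUnit_two_map (T.basicOpen (coord (ρ p.1) p.2)).ι h.isUnit_two)
      (mapRep_minor _ h.minor_eq_zero)
      (mapRep_disc _ h.disc_eq_zero) (isUnit_coord_basicOpen ρ p)) <| by
    intro p q
    let V := fun p : Γ × Fin 3 ↦ T.basicOpen (coord (ρ p.1) p.2)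
    have hq : mapRep (pullback.snd (V p).ι (V q).ι).appTop.hom (mapRep (V q).ι.appTop.hom ρ) =
        mapRep (pullback.fst (V p).ι (V q).ι).appTop.hom (mapRep (V p).ι.appTop.hom ρ) := by
      rw [mapRep_mapRep, mapRep_mapRep, ← CommRingCat.hom_comp, ← CommRingCat.hom_comp,
        ← Scheme.Hom.comp_appTop, ← Scheme.Hom.comp_appTop, pullback.condition]
    have hp' : IsUnit (coord (mapRep (pullback.fst (V p).ι (V q).ι).appTop.hom
        (mapRep (V p).ι.appTop.hom ρ) p.1) p.2) := by
      have := (isUnit_coord_basicOpen ρ p).map (pullback.fst (V p).ι (V q).ι).appTop.hom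
      rw [← map_coord] at this
      exact this
    have hq' : IsUnit (coord (mapRep (pullback.fst (V p).ι (V q).ι).appTop.hom
        (mapRep (V p).ι.appTop.hom ρ) q.1) q.2) := by
      rw [← hq]
      have := (isUnit_coord_basicOpen ρ q).map (pullback.snd (V p).ι (V q).ι).appTop.hom
      rw [← map_coord] at this
      exact this
    have hm' := mapRep_minor (pullback.fst (V p).ι (V q).ι)
      (mapRep_minor (V p).ι h.minor_eq_zero)
    have hd' := mapRep_disc (pullback.fst (V p).ι (V q).ι)
      (mapRep_disc (V p).ι h.disc_eq_zero)
    have h2' := isUnit_two_map (pullback.fst (V p).ι (V q).ι ≫ (V p).ι) h.isUnit_two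
    exact (comp_chPoint _ _ _ _ _ rfl h2' hm' hd' hp').trans
      ((chPoint_eq _ h2' hm' hd' hp' hq').trans (comp_chPoint _ _ _ _ _ hq h2' hm' hd' hq').symm)

variable (Γ) in
/-- The morphism `π_{Γ,u} : Rep₂(Γ)_u → Ch₂(Γ)_u` over `ℤ[1/2]`. -/
def piU : RepU Γ ⟶ ChU Γ :=
  Over.homMk (toChU (pointRep (𝟙 (RepUScheme Γ))) (isUnipotentRep_pointRep _))
    (Subsingleton.elim _ _)

end Quotient

section GeometricQuotient
variable {S : Scheme.{u}} {G X Y : Over S}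

/-- A right action of a group scheme `G` on a scheme `X` over `S`. -/
structure IsRightAction [GrpObj G] (σ : X ⊗ G ⟶ X) : Prop where
  one : X ◁ MonObj.one ≫ σ = (ρ_ X).hom
  mul : σ ▷ G ≫ σ = (α_ X G G).hom ≫ X ◁ MonObj.mul ≫ σ

/-- Geometric quotients: for an action `σ` of `G` on `X` over `S`, the morphism `π : X → Y` is
invariant and surjective, the image of `(σ, pr₁) : X × G → X × X` is `X ×_Y X`, the topology of
`Y` is the quotient topology, and `𝒪_Y` is the sheaf of invariant functions. -/
structure IsGeometricQuotient (σ : X ⊗ G ⟶ X) (π : X ⟶ Y) : Prop where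
  invariant : σ ≫ π = fst X G ≫ π
  surjective : Surjective π.left
  orbits : Surjective (pullback.lift σ.left (fst X G).left
    (congr($(invariant).left)) : (X ⊗ G).left ⟶ pullback π.left π.left)
  submersive : Topology.IsQuotientMap π.left
  app_injective : ∀ U : Y.left.Opens, Function.Injective (π.left.app U)
  range_app : ∀ (U : Y.left.Opens) (f : Γ(X.left, π.left ⁻¹ᵁ U)),
    f ∈ Set.range (π.left.app U) ↔
      σ.left.appLE (π.left ⁻¹ᵁ U) ((fst X G ≫ π).left ⁻¹ᵁ U) (by rw [← invariant]; rfl) f =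
        (fst X G).left.appLE (π.left ⁻¹ᵁ U) ((fst X G ≫ π).left ⁻¹ᵁ U) le_rfl f

/-- Universal geometric quotients: for every morphism `Y' → Y`, the base change
`X ×_Y Y' → Y'` is a geometric quotient for the induced action of `G` on `X ×_Y Y'`. -/
def IsUniversalGeometricQuotient (σ : X ⊗ G ⟶ X) (π : X ⟶ Y) : Prop :=
  IsGeometricQuotient σ π ∧
    ∀ (X' Y' : Over S) (f : Y' ⟶ Y) (g : X' ⟶ X) (π' : X' ⟶ Y'), IsPullback g π' π f →
      ∀ σ' : X' ⊗ G ⟶ X', σ' ≫ g = g ▷ G ≫ σ → σ' ≫ π' = fst X' G ≫ π' →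
        IsGeometricQuotient σ' π'

end GeometricQuotient

end

end UnipotentMold

open UnipotentMold

/-!
On the open subscheme where `ρ(α)` is nowhere scalar, a representation with unipotent mold has the
form `ρ(γ) = r(γ) + a(γ) N`, where `r = tr(ρ)/2` is a character, `N = η(ρ(α))` is a nowhere
vanishing matrix with trace `0` and square `0`, and `a` is a derivation with respect to `r` with
`a(α) = 1`. The pair `(r, a)` is a point of `D₊(dα) ⊆ Ch₂(Γ)_u`, and `π` forgets `N`. Thus over
`D₊(dα)` the morphism `π` is a projection, whose fibre is the scheme of nonzero nilpotent matrices.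

This gives a section over each `D₊(dα)`, with `N = E₁₂` (`hasLocalSections_piU`). Moreover a matrix
`N` as above is Zariski-locally conjugate to `E₁₂`: one of its off-diagonal entries is invertible,
and then `Nv` and `v` form a basis for one of the standard basis vectors `v`
(`exists_matAut_single`). So two points of `Rep₂(Γ)_u` with the same image in `Ch₂(Γ)_u` are locally
conjugate (`locallyConjugate_actionU_piU`). Together with the invariance of `(r, a)` under
conjugation (`actionU_comp_piU`), these two facts imply formally that `π` is a geometric quotient,
and they are stable under base change (`isUniversalGeometricQuotient_of_local`).

For representability (`bijOn_pointRep`), the equations of `Rep₂(Γ)_u` imply that `𝒪[ρ(Γ)]` has the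
local basis `1`, `N`, with free quotient. Conversely, a mold of rank `2` forces the minors of order
`3` to vanish, and since it is a local direct summand it cannot consist of scalar matrices at any
point (`exists_coord_notMem`). The axioms of an action are checked on points.
-/

namespace UnipotentMold

/-! ### A criterion for universal geometric quotients -/

section Criterion

lemma apply_apply_of_comp_eq {A B C : Scheme.{u}} {f : A ⟶ B} {g : B ⟶ C} {h : A ⟶ C}
    (e : f ≫ g = h) (a : A) : g (f a) = h a := by
  rw [← e, Scheme.Hom.comp_apply]

lemma appLE_appLE_of_comp_eq {A B C : Scheme.{u}} {f : A ⟶ B} {g : B ⟶ C} {h : A ⟶ C}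
    (e : f ≫ g = h) {U : C.Opens} {V : B.Opens} {W : A.Opens} (hV : V ≤ g ⁻¹ᵁ U)
    (hW : W ≤ f ⁻¹ᵁ V) (a : Γ(C, U)) :
    f.appLE V W hW (g.appLE U V hV a) =
      h.appLE U W (by rw [← e]; exact hW.trans fun _ hx ↦ hV hx) a := by
  subst e
  rw [← CommRingCat.comp_apply, Scheme.Hom.appLE_comp_appLE]

lemma section_ext {T : Scheme.{u}} {W : T.Opens} {f g : Γ(T, W)} {U : T → T.Opens}
    (hU : ∀ t, t ∈ U t) (h : ∀ t, (U t).ι.app W f = (U t).ι.app W g) : f = g :=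
  Scheme.OpenCover.ext_elem f g (T.openCoverOfIsOpenCover U
    (TopologicalSpace.IsOpenCover.mk (top_le_iff.mp fun t _ ↦
      TopologicalSpace.Opens.mem_iSup.mpr ⟨t, hU t⟩))) h

variable {S : Scheme.{u}} {G X Y : Over S}

/-- The morphism `π` has sections Zariski-locally on its target. -/
def HasLocalSections (π : X ⟶ Y) : Prop :=
  ∀ y : Y.left, ∃ (U : Y.left.Opens) (s : U.toScheme ⟶ X.left), y ∈ U ∧ s ≫ π.left = U.ι

/-- An open subscheme of a scheme over `S`, as a scheme over `S`. -/
abbrev overOpen (T : Over S) (U : T.left.Opens) : Over S := Over.mk (U.ι ≫ T.hom)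

/-- The inclusion of an open subscheme, as a morphism over `S`. -/
abbrev overOpenι (T : Over S) (U : T.left.Opens) : overOpen T U ⟶ T := Over.homMk U.ι

/-- Any two `T`-valued points of `X` with the same image under `π` are, Zariski-locally on `T`,
conjugate under `G`. -/
def LocallyConjugate (σ : X ⊗ G ⟶ X) (π : X ⟶ Y) : Prop :=
  ∀ ⦃T : Over S⦄ (x₁ x₂ : T ⟶ X), x₁ ≫ π = x₂ ≫ π → ∀ t : T.left,
    ∃ (U : T.left.Opens) (φ : overOpen T U ⟶ G), t ∈ U ∧
      overOpenι T U ≫ x₂ = lift (overOpenι T U ≫ x₁) φ ≫ σ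

lemma HasLocalSections.baseChange {π : X ⟶ Y} (h : HasLocalSections π) {X' Y' : Over S}
    {f : Y' ⟶ Y} {g : X' ⟶ X} {π' : X' ⟶ Y'} (hp : IsPullback g π' π f) :
    HasLocalSections π' := by
  intro y
  obtain ⟨U, s, hy, hs⟩ := h (f.left y)
  refine ⟨f.left ⁻¹ᵁ U, ?_⟩
  let V : Over S := overOpen Y' (f.left ⁻¹ᵁ U)
  have hs' : (f.left ∣_ U ≫ s) ≫ X.hom = (f.left ⁻¹ᵁ U).ι ≫ Y'.hom := by
    rw [← Over.w π, Category.assoc, reassoc_of% hs, morphismRestrict_ι_assoc, Over.w]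
  let a : V ⟶ X := Over.homMk (f.left ∣_ U ≫ s) hs'
  have ha : a ≫ π = overOpenι Y' (f.left ⁻¹ᵁ U) ≫ f := by
    ext1
    simp [a, hs, V, morphismRestrict_ι]
  refine ⟨(hp.lift a (overOpenι Y' _) ha).left, hy, ?_⟩
  exact congr($(hp.lift_snd a (overOpenι Y' _) ha).left)

lemma LocallyConjugate.baseChange {σ : X ⊗ G ⟶ X} {π : X ⟶ Y} (h : LocallyConjugate σ π)
    {X' Y' : Over S} {f : Y' ⟶ Y} {g : X' ⟶ X} {π' : X' ⟶ Y'} (hp : IsPullback g π' π f)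
    {σ' : X' ⊗ G ⟶ X'} (hg : σ' ≫ g = g ▷ G ≫ σ) (hinv : σ' ≫ π' = fst X' G ≫ π') :
    LocallyConjugate σ' π' := by
  intro T x₁ x₂ hx t
  obtain ⟨U, φ, ht, hφ⟩ := h (x₁ ≫ g) (x₂ ≫ g)
    (by rw [Category.assoc, Category.assoc, hp.w, reassoc_of% hx]) t
  refine ⟨U, φ, ht, hp.hom_ext ?_ ?_⟩
  · simp [hg, hφ]
  · simp [hinv, hx]

/-- An invariant function takes the same value at two points with the same image under `π`, because
these points are locally conjugate. -/
lemma LocallyConjugate.appLE_eq {σ : X ⊗ G ⟶ X} {π : X ⟶ Y} (h : LocallyConjugate σ π)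
    {W : X.left.Opens} {W' : (X ⊗ G).left.Opens} (hW₁ : W' ≤ σ.left ⁻¹ᵁ W)
    (hW₂ : W' = (fst X G).left ⁻¹ᵁ W) {f : Γ(X.left, W)}
    (hf : σ.left.appLE W W' hW₁ f = (fst X G).left.appLE W W' hW₂.le f)
    {T : Over S} (x₁ x₂ : T ⟶ X) (hx : x₁ ≫ π = x₂ ≫ π) (Z : T.left.Opens)
    (h₁ : Z ≤ x₁.left ⁻¹ᵁ W) (h₂ : Z ≤ x₂.left ⁻¹ᵁ W) :
    x₁.left.appLE W Z h₁ f = x₂.left.appLE W Z h₂ f := by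
  choose U φ hU hφ using h x₁ x₂ hx
  refine section_ext hU fun t ↦ ?_
  have hfst : lift (overOpenι T (U t) ≫ x₁) (φ t) ≫ fst X G = overOpenι T (U t) ≫ x₁ :=
    lift_fst _ _
  set l := lift (overOpenι T (U t) ≫ x₁) (φ t)
  have e₁ : l.left ≫ (fst X G).left = (U t).ι ≫ x₁.left := congr($(hfst).left)
  have e₂ : l.left ≫ σ.left = (U t).ι ≫ x₂.left := congr($((hφ t).symm).left)
  have hl : (U t).ι ⁻¹ᵁ Z ≤ l.left ⁻¹ᵁ W' := by
    rw [hW₂, ← Scheme.Hom.comp_preimage, e₁]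
    exact fun z hz ↦ h₁ hz
  have key (p : (X ⊗ G).left ⟶ X.left) (x : T.left ⟶ X.left) (e : l.left ≫ p = (U t).ι ≫ x)
      (hp : W' ≤ p ⁻¹ᵁ W) (hx : Z ≤ x ⁻¹ᵁ W) :
      (U t).ι.app Z (x.appLE W Z hx f) = l.left.appLE W' _ hl (p.appLE W W' hp f) := by
    rw [appLE_appLE_of_comp_eq e, Scheme.Hom.app_eq_appLE, appLE_appLE_of_comp_eq rfl]
  rw [key _ _ e₁ hW₂.le h₁, key _ _ e₂ hW₁ h₂, hf]

lemma HasLocalSections.exists_overOpen {π : X ⟶ Y} (h : HasLocalSections π) (y : Y.left) :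
    ∃ (V : Y.left.Opens) (s : overOpen Y V ⟶ X), y ∈ V ∧ s ≫ π = overOpenι Y V := by
  obtain ⟨V, s, hy, hs⟩ := h y
  refine ⟨V, Over.homMk s ?_, hy, by ext1; exact hs⟩
  rw [← Over.w π, reassoc_of% hs]
  rfl

/-- An invariant morphism with local sections whose fibres are local orbits is a geometric quotient.
The local sections give surjectivity, the quotient topology and the injectivity on functions. An
invariant function descends to its pullbacks along the local sections, which glue because they
become equal to the given function on `X`. -/
theorem isGeometricQuotient_of_local {σ : X ⊗ G ⟶ X} {π : X ⟶ Y}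
    (hinv : σ ≫ π = fst X G ≫ π) (hs : HasLocalSections π) (hc : LocallyConjugate σ π) :
    IsGeometricQuotient σ π := by
  have hsurj : Function.Surjective π.left := fun y ↦ by
    obtain ⟨U, s, hy, hs⟩ := hs y
    exact ⟨s ⟨y, hy⟩, apply_apply_of_comp_eq hs _⟩
  have hinj (U : Y.left.Opens) : Function.Injective (π.left.app U) := by
    intro a b hab
    choose V s hV hs using hs
    refine section_ext hV fun t ↦ ?_
    have key (c : Γ(Y.left, U)) : (V t).ι.app U c =
        (s t).appLE (π.left ⁻¹ᵁ U) ((V t).ι ⁻¹ᵁ U)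
          (by rw [← Scheme.Hom.comp_preimage, hs]) (π.left.app U c) := by
      rw [Scheme.Hom.app_eq_appLE, Scheme.Hom.app_eq_appLE, appLE_appLE_of_comp_eq (hs t)]
    rw [key, key, hab]
  refine ⟨hinv, ⟨hsurj⟩, ⟨fun z ↦ ?_⟩, ?_, hinj, fun U f ↦ ⟨?_, fun hf ↦ ?_⟩⟩
  · -- the two projections are two points of `X` with the same image in `Y`
    let T : Over S := Over.mk (pullback.fst π.left π.left ≫ X.hom)
    let x₁ : T ⟶ X := Over.homMk (pullback.fst π.left π.left)
    let x₂ : T ⟶ X := Over.homMk (pullback.snd π.left π.left) (by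
      change pullback.snd π.left π.left ≫ X.hom = pullback.fst π.left π.left ≫ X.hom
      rw [← Over.w π, pullback.condition_assoc])
    obtain ⟨U, φ, hz, hφ⟩ := hc x₂ x₁ (by ext1; exact pullback.condition.symm) z
    refine ⟨(lift (overOpenι T U ≫ x₂) φ).left ⟨z, hz⟩, ?_⟩
    refine (apply_apply_of_comp_eq (h := U.ι) ?_ _).trans (by rfl)
    apply pullback.hom_ext
    · rw [Category.assoc, pullback.lift_fst]
      exact congr($(hφ.symm).left)
    · rw [Category.assoc, pullback.lift_snd]
      exact congr($(lift_fst (overOpenι T U ≫ x₂) φ).left)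
  · refine ⟨.of_isOpen_preimage_iff_isOpen fun A ↦
      ⟨fun hA ↦ ?_, fun hA ↦ hA.preimage π.left.continuous⟩, hsurj⟩
    rw [isOpen_iff_forall_mem_open]
    intro y hy
    -- on `U`, the set `A` is the preimage under `s` of its preimage in `X`
    obtain ⟨U, s, hyU, hs⟩ := hs y
    refine ⟨(U.ι '' (s ⁻¹' (π.left ⁻¹' A))), ?_,
      U.ι.isOpenEmbedding.isOpenMap _ (hA.preimage s.continuous), ?_⟩
    · rintro _ ⟨z, hz, rfl⟩
      rw [← apply_apply_of_comp_eq hs]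
      exact hz
    · exact ⟨⟨y, hyU⟩, show π.left (s ⟨y, hyU⟩) ∈ A from
        Set.mem_of_eq_of_mem (apply_apply_of_comp_eq hs _) hy, rfl⟩
  · rintro ⟨g, rfl⟩
    rw [Scheme.Hom.app_eq_appLE]
    exact (appLE_appLE_of_comp_eq congr($(hinv).left) _ _ g).trans
      (appLE_appLE_of_comp_eq (h := (fst X G ≫ π).left) rfl _ _ g).symm
  · have heq {T : Over S} (x₁ x₂ : T ⟶ X) := hc.appLE_eq (W := π.left ⁻¹ᵁ U)
      (W' := (fst X G ≫ π).left ⁻¹ᵁ U) (f := f) _ rfl hf x₁ x₂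
    choose V s hV hs using hs.exists_overOpen
    have hs' (y : Y.left) : (s y).left ≫ π.left = (V y).ι := congr($(hs y).left)
    -- the function obtained by pulling back `f` along the local section `s y`
    let V' (y : Y.left) : Y.left.Opens := (V y).ι ''ᵁ ((V y).ι ⁻¹ᵁ U)
    have hV' (y : Y.left) : V' y = V y ⊓ U := by
      simp only [V', Scheme.Hom.image_preimage_eq_opensRange_inf, Scheme.Opens.opensRange_ι]
    have hle (y : Y.left) : V' y ≤ U := (hV' y).le.trans inf_le_right
    have hle' (y : Y.left) : V' y ≤ V y := (hV' y).le.trans inf_le_left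
    have hsU (y : Y.left) : (V y).ι ⁻¹ᵁ U ≤ (s y).left ⁻¹ᵁ (π.left ⁻¹ᵁ U) := by
      rw [← Scheme.Hom.comp_preimage, hs']
    let g (y : Y.left) : Γ(Y.left, V' y) := ((V y).ι.appIso ((V y).ι ⁻¹ᵁ U)).inv
      ((s y).left.appLE (π.left ⁻¹ᵁ U) ((V y).ι ⁻¹ᵁ U) (hsU y) f)
    have hg (y : Y.left) : π.left.app (V' y) (g y) =
        X.left.presheaf.map (homOfLE (show π.left ⁻¹ᵁ V' y ≤ π.left ⁻¹ᵁ U from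
          fun _ hx ↦ hle y hx)).op f := by
      -- over `V y`, compare the identity of `X` with `s y ∘ π`: they have the same image in `Y`
      let T : Over S := overOpen X (π.left ⁻¹ᵁ V y)
      let p : T ⟶ overOpen Y (V y) := Over.homMk (π.left ∣_ V y) (by
        change π.left ∣_ V y ≫ (V y).ι ≫ Y.hom = (π.left ⁻¹ᵁ V y).ι ≫ X.hom
        rw [morphismRestrict_ι_assoc, Over.w])
      have hp : p.left ≫ (V y).ι = (π.left ⁻¹ᵁ V y).ι ≫ π.left := morphismRestrict_ι _ _
      have hpι : overOpenι X (π.left ⁻¹ᵁ V y) ≫ π = (p ≫ s y) ≫ π := by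
        rw [Category.assoc, hs]
        ext1
        exact hp.symm
      have : IsIso ((π.left ⁻¹ᵁ V y).ι.app (π.left ⁻¹ᵁ V' y)) :=
        Scheme.Hom.isIso_app _ _ (by
          rw [Scheme.Opens.opensRange_ι]
          exact fun _ hx ↦ hle' y hx)
      apply (ConcreteCategory.bijective_of_isIso
        ((π.left ⁻¹ᵁ V y).ι.app (π.left ⁻¹ᵁ V' y))).injective
      have h₁ : (π.left ⁻¹ᵁ V y).ι ⁻¹ᵁ (π.left ⁻¹ᵁ V' y) ≤
          (p ≫ s y).left ⁻¹ᵁ (π.left ⁻¹ᵁ U) := by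
        change _ ≤ ((p ≫ s y) ≫ π).left ⁻¹ᵁ U
        rw [← hpι]
        exact fun _ hx ↦ hle y hx
      have e₁ := heq (overOpenι X (π.left ⁻¹ᵁ V y)) (p ≫ s y) hpι
        ((π.left ⁻¹ᵁ V y).ι ⁻¹ᵁ (π.left ⁻¹ᵁ V' y)) (fun _ hx ↦ hle y hx) h₁
      have e₂ : (V y).ι.appLE (V' y) ((V y).ι ⁻¹ᵁ U)
          ((V y).ι.preimage_image_eq _).ge (g y) =
          (s y).left.appLE (π.left ⁻¹ᵁ U) ((V y).ι ⁻¹ᵁ U) (hsU y) f := by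
        simp only [g, V']
        rw [← CommRingCat.comp_apply, Scheme.Hom.appIso_inv_appLE]
        exact congr($((V y).toScheme.presheaf.map_id _) _)
      have h₂ : (π.left ⁻¹ᵁ V y).ι ⁻¹ᵁ (π.left ⁻¹ᵁ V' y) ≤ p.left ⁻¹ᵁ ((V y).ι ⁻¹ᵁ U) := by
        change _ ≤ (p.left ≫ (V y).ι) ⁻¹ᵁ U
        rw [hp]
        exact fun _ hx ↦ hle y hx
      trans (p ≫ s y).left.appLE (π.left ⁻¹ᵁ U) _ h₁ f
      · rw [Scheme.Hom.app_eq_appLE, Scheme.Hom.app_eq_appLE, appLE_appLE_of_comp_eq rfl,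
          ← appLE_appLE_of_comp_eq (show p.left ≫ (s y).left = (p ≫ s y).left from rfl) (hsU y) h₂,
          ← e₂, appLE_appLE_of_comp_eq hp]
      · rw [← e₁, Scheme.Hom.app_eq_appLE, ← CommRingCat.comp_apply, Scheme.Hom.map_appLE]
        rfl
    have hnat {A B : Y.left.Opens} (i : A ⟶ B) (a : Γ(Y.left, B)) :
        π.left.app A (Y.left.presheaf.map i.op a) = X.left.presheaf.map
          (homOfLE (show π.left ⁻¹ᵁ A ≤ π.left ⁻¹ᵁ B from fun _ hx ↦ i.le hx)).op
            (π.left.app B a) := by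
      rw [← CommRingCat.comp_apply, ← CommRingCat.comp_apply]
      exact congr($(Scheme.Hom.naturality π.left i.op) a)
    have hcov : U ≤ ⨆ y, V' y := fun y hy ↦
      TopologicalSpace.Opens.mem_iSup.mpr ⟨y, (hV' y).ge ⟨hV y, hy⟩⟩
    obtain ⟨F, hF, -⟩ := TopCat.Sheaf.existsUnique_gluing' Y.left.sheaf V' U
      (fun y ↦ homOfLE (hle y)) hcov g (fun y z ↦ by
        apply hinj
        refine (hnat _ _).trans (Eq.trans ?_ (hnat _ _).symm)
        rw [hg, hg, ← CommRingCat.comp_apply, ← CommRingCat.comp_apply, ← Functor.map_comp,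
          ← Functor.map_comp]
        rfl)
    refine ⟨F, TopCat.Sheaf.eq_of_locally_eq' X.left.sheaf (fun y ↦ π.left ⁻¹ᵁ V' y) _
      (fun y ↦ homOfLE fun _ hx ↦ hle y hx) (fun x hx ↦ ?_) _ _ fun y ↦ ?_⟩
    · obtain ⟨y, hy⟩ := TopologicalSpace.Opens.mem_iSup.mp (hcov hx)
      exact TopologicalSpace.Opens.mem_iSup.mpr ⟨y, hy⟩
    · exact (hnat (homOfLE (hle y)) F).symm.trans ((congrArg _ (hF y)).trans (hg y))

/-- The hypotheses of `isGeometricQuotient_of_local` are stable under base change. -/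
theorem isUniversalGeometricQuotient_of_local {σ : X ⊗ G ⟶ X} {π : X ⟶ Y}
    (hinv : σ ≫ π = fst X G ≫ π) (hs : HasLocalSections π) (hc : LocallyConjugate σ π) :
    IsUniversalGeometricQuotient σ π :=
  ⟨isGeometricQuotient_of_local hinv hs hc, fun _ _ _ _ _ hp _ hg hinv' ↦
    isGeometricQuotient_of_local hinv' (hs.baseChange hp) (hc.baseChange hp hg hinv')⟩

end Criterion

/-! ### Representability -/

section Mold

variable {Γ : Type u} [Monoid Γ] {R : Type u} [CommRing R]

/-- The entry `coord X i` as a linear function of `X`. -/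
def coordₗ (i : Fin 3) : Matrix (Fin 2) (Fin 2) R →ₗ[R] R where
  toFun X := coord X i
  map_add' X Y := by fin_cases i <;> simp [coord]; ring
  map_smul' c X := by fin_cases i <;> simp [coord]; ring

lemma coordₗ_apply (i : Fin 3) (X : Matrix (Fin 2) (Fin 2) R) : coordₗ i X = coord X i := rfl

lemma exists_coord_eq (c : Fin 3 → R) : ∃ X : Matrix (Fin 2) (Fin 2) R, ∀ j, coord X j = c j :=
  ⟨!![c 2, c 0; c 1, 0], fun j ↦ by fin_cases j <;> simp [coord]⟩

/-- `R[ρ(Γ)]` is spanned by `1` and `η(ρ(α))`, which squares to zero. -/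
lemma mem_adjoin_range_iff {ρ : Γ →* Matrix (Fin 2) (Fin 2) R} (h2 : IsUnit (2 : R))
    (hm : ∀ g r, minor ρ g r = 0) (hd : ∀ γ, disc (ρ γ) = 0) {α : Γ} {i : Fin 3}
    (hu : IsUnit (coord (ρ α) i)) (X : Matrix (Fin 2) (Fin 2) R) :
    X ∈ Algebra.adjoin R (Set.range ρ) ↔ ∃ a b : R, X = a • 1 + b • eta h2 (ρ α) := by
  constructor
  · intro hX
    induction hX using Algebra.adjoin_induction with
    | mem x hx =>
      obtain ⟨γ, rfl⟩ := hx
      exact ⟨_, _, rep_eq h2 hm hu γ⟩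
    | algebraMap r => exact ⟨r, 0, by rw [zero_smul, add_zero, Algebra.algebraMap_eq_smul_one]⟩
    | add x y _ _ hx hy =>
      obtain ⟨a, b, rfl⟩ := hx
      obtain ⟨c, d, rfl⟩ := hy
      exact ⟨a + c, b + d, by simp only [add_smul]; abel⟩
    | mul x y _ _ hx hy =>
      obtain ⟨a, b, rfl⟩ := hx
      obtain ⟨c, d, rfl⟩ := hy
      refine ⟨a * c, a * d + b * c, ?_⟩
      simp only [add_mul, mul_add, smul_mul_smul_comm, eta_mul_eta h2 (hd α), mul_one, one_mul,
        smul_zero, add_zero, add_smul]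
      abel
  · rintro ⟨a, b, rfl⟩
    have h1 : (1 : Matrix (Fin 2) (Fin 2) R) ∈ Algebra.adjoin R (Set.range ρ) := one_mem _
    exact add_mem (Subalgebra.smul_mem _ h1 a) (Subalgebra.smul_mem _
      (sub_mem (Algebra.subset_adjoin (Set.mem_range_self α)) (Subalgebra.smul_mem _ h1 _)) b)

lemma disc_smul_one_add (h2 : IsUnit (2 : R)) {X : Matrix (Fin 2) (Fin 2) R} (h : disc X = 0)
    (a b : R) : disc (a • 1 + b • eta h2 X) = 0 := by
  have ht := two_mul_halfTrace h2 X
  rw [disc, Matrix.trace_fin_two, Matrix.det_fin_two] at h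
  rw [Matrix.trace_fin_two] at ht
  simp [disc, eta, Matrix.trace_fin_two, Matrix.det_fin_two]
  linear_combination b ^ 2 * h

/-- The spanning set `1`, `η(ρ(α))` of `R[ρ(Γ)]` is a basis, since `η(ρ(α))` has an invertible
coordinate modulo scalar matrices. -/
lemma free_and_finrank_adjoin_range [Nontrivial R] {ρ : Γ →* Matrix (Fin 2) (Fin 2) R}
    (h2 : IsUnit (2 : R)) (hm : ∀ g r, minor ρ g r = 0) (hd : ∀ γ, disc (ρ γ) = 0) {α : Γ}
    {i : Fin 3} (hu : IsUnit (coord (ρ α) i)) :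
    Module.Free R (Algebra.adjoin R (Set.range ρ)) ∧
      Module.finrank R (Algebra.adjoin R (Set.range ρ)) = 2 := by
  have hmem := mem_adjoin_range_iff h2 hm hd hu
  let f : (R × R) →ₗ[R] Algebra.adjoin R (Set.range ρ) :=
    LinearMap.codRestrict (Subalgebra.toSubmodule (Algebra.adjoin R (Set.range ρ)))
      ((LinearMap.fst R R R).smulRight 1 + (LinearMap.snd R R R).smulRight (eta h2 (ρ α)))
      fun p ↦ (hmem _).mpr ⟨p.1, p.2, rfl⟩
  have hf (p : R × R) :
      (f p : Matrix (Fin 2) (Fin 2) R) = p.1 • 1 + p.2 • eta h2 (ρ α) := rfl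
  have hbij : Function.Bijective f := by
    refine ⟨(injective_iff_map_eq_zero f).mpr fun p hp ↦ ?_, fun X ↦ ?_⟩
    · have h0 : p.1 • (1 : Matrix (Fin 2) (Fin 2) R) + p.2 • eta h2 (ρ α) = 0 := by
        rw [← hf, hp]; rfl
      have h1 : p.2 = 0 := by
        have := coord_smul_one_add p.1 p.2 (eta h2 (ρ α)) i
        rw [h0, coord_eta, ← coordₗ_apply, map_zero] at this
        exact hu.mul_right_cancel (by rw [← this, zero_mul])
      rw [h1, zero_smul, add_zero] at h0
      have := congr($h0 0 0)
      exact Prod.ext (by simpa using this) h1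
    · obtain ⟨a, b, h⟩ := (hmem X).mp X.2
      exact ⟨(a, b), Subtype.ext h.symm⟩
  let e := LinearEquiv.ofBijective f hbij
  refine ⟨Module.Free.of_equiv e, ?_⟩
  rw [← e.finrank_eq]
  simp

/-- Modulo `R[ρ(Γ)]`, a matrix is determined by two of its coordinates after the invertible one has
been cleared. -/
lemma free_quotient_adjoin_range {ρ : Γ →* Matrix (Fin 2) (Fin 2) R}
    (h2 : IsUnit (2 : R)) (hm : ∀ g r, minor ρ g r = 0) (hd : ∀ γ, disc (ρ γ) = 0) {α : Γ}
    {i : Fin 3} (hu : IsUnit (coord (ρ α) i)) :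
    Module.Free R (Matrix (Fin 2) (Fin 2) R ⧸
      Subalgebra.toSubmodule (Algebra.adjoin R (Set.range ρ))) := by
  have hmem := mem_adjoin_range_iff h2 hm hd hu
  let q : Matrix (Fin 2) (Fin 2) R →ₗ[R] ({j // j ≠ i} → R) :=
    LinearMap.pi fun j ↦ coordₗ j.1 - (↑hu.unit⁻¹ * coord (ρ α) j.1) • coordₗ i
  have hq (X) (j : {j // j ≠ i}) : q X j =
      coord X j.1 - ↑hu.unit⁻¹ * coord (ρ α) j.1 * coord X i := rfl
  have hsurj : Function.Surjective q := by
    intro w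
    obtain ⟨X, hX⟩ := exists_coord_eq fun j ↦ if h : j = i then (0 : R) else w ⟨j, h⟩
    refine ⟨X, funext fun j ↦ ?_⟩
    rw [hq, hX, hX, dif_neg j.2, dif_pos rfl, mul_zero, sub_zero]
  have hker : LinearMap.ker q = Subalgebra.toSubmodule (Algebra.adjoin R (Set.range ρ)) := by
    ext X
    rw [LinearMap.mem_ker, Subalgebra.mem_toSubmodule, hmem]
    constructor
    · intro h
      refine ⟨halfTrace h2 X, coord X i * ↑hu.unit⁻¹, matrix_ext_of_coord h2 ?_ fun j ↦ ?_⟩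
      · rw [Matrix.trace_add, Matrix.trace_smul, Matrix.trace_smul, trace_eta, Matrix.trace_one,
          ← two_mul_halfTrace h2 X]
        simp [mul_comm]
      · rw [coord_smul_one_add, coord_eta]
        by_cases hj : j = i
        · rw [hj, mul_assoc, hu.val_inv_mul, mul_one]
        · have := congr($h ⟨j, hj⟩)
          rw [hq, Pi.zero_apply] at this
          linear_combination this
    · rintro ⟨a, b, rfl⟩
      funext j
      rw [hq, coord_smul_one_add, coord_smul_one_add, coord_eta, coord_eta, Pi.zero_apply]
      linear_combination (-b * coord (ρ α) j.1) * hu.val_inv_mul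
  exact Module.Free.of_equiv
    ((Submodule.quotEquivOfEq _ _ hker.symm).trans (q.quotKerEquivOfSurjective hsurj)).symm

/-- In a free module of rank `2`, the minors of order `3` vanish. -/
lemma minor_eq_zero_of_finrank [Nontrivial R] {ρ : Γ →* Matrix (Fin 2) (Fin 2) R}
    (B : Submodule R (Matrix (Fin 2) (Fin 2) R)) (hB : ∀ γ, ρ γ ∈ B) [Module.Free R B]
    (h : Module.finrank R B = 2) (g : Fin 3 → Γ) (r : Fin 3 → Fin 2 × Fin 2) :
    minor ρ g r = 0 := by
  have : Module.Finite R B := Module.finite_of_finrank_pos (by omega)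
  let b := Module.finBasisOfFinrankEq R B h
  have key (γ : Γ) : ρ γ = b.repr ⟨ρ γ, hB γ⟩ 0 • (b 0 : Matrix (Fin 2) (Fin 2) R) +
      b.repr ⟨ρ γ, hB γ⟩ 1 • (b 1 : Matrix (Fin 2) (Fin 2) R) := by
    have := congr(($(b.sum_repr ⟨ρ γ, hB γ⟩) : Matrix (Fin 2) (Fin 2) R))
    rw [Fin.sum_univ_two] at this
    exact this.symm
  rw [minor, Matrix.det_fin_three]
  simp only [Matrix.of_apply]
  rw [key (g 0), key (g 1), key (g 2)]
  simp only [Matrix.add_apply, Matrix.smul_apply, smul_eq_mul]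
  ring

/-- The matrices which are scalar modulo an ideal. -/
def scalarMod (I : Ideal R) : Subalgebra R (Matrix (Fin 2) (Fin 2) R) where
  carrier := {X | ∀ i, coord X i ∈ I}
  mul_mem' {X Y} hX hY i := by
    have a0 : X 0 1 ∈ I := hX 0
    have a1 : X 1 0 ∈ I := hX 1
    have a2 : X 0 0 - X 1 1 ∈ I := hX 2
    have b0 : Y 0 1 ∈ I := hY 0
    have b1 : Y 1 0 ∈ I := hY 1
    have b2 : Y 0 0 - Y 1 1 ∈ I := hY 2
    fin_cases i
    · simp only [coord, Matrix.mul_apply, Fin.sum_univ_two]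
      exact add_mem (I.mul_mem_left _ b0) (I.mul_mem_right _ a0)
    · simp only [coord, Matrix.mul_apply, Fin.sum_univ_two]
      exact add_mem (I.mul_mem_right _ a1) (I.mul_mem_left _ b1)
    · have : coord (X * Y) 2 = X 0 0 * (Y 0 0 - Y 1 1) + Y 1 1 * (X 0 0 - X 1 1) + X 0 1 * Y 1 0
          - X 1 0 * Y 0 1 := by
        simp [coord, Matrix.mul_apply, Fin.sum_univ_two]
        ring
      exact this ▸ sub_mem (add_mem (add_mem (I.mul_mem_left _ b2) (I.mul_mem_left _ a2))
        (I.mul_mem_right _ a0)) (I.mul_mem_right _ a1)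
  add_mem' {X Y} hX hY i := by
    rw [← coordₗ_apply, map_add]
    exact add_mem (hX i) (hY i)
  algebraMap_mem' c i := by
    fin_cases i <;> simp [coord, Matrix.algebraMap_matrix_apply]

/-- A direct summand of rank `2` of `M₂(R)` which contains `1` does not consist of matrices that are
scalar modulo a proper ideal. -/
lemma exists_coord_notMem [Nontrivial R] {ρ : Γ →* Matrix (Fin 2) (Fin 2) R}
    [Module.Free R (Algebra.adjoin R (Set.range ρ))]
    (h : Module.finrank R (Algebra.adjoin R (Set.range ρ)) = 2)
    [Module.Free R (Matrix (Fin 2) (Fin 2) R ⧸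
      Subalgebra.toSubmodule (Algebra.adjoin R (Set.range ρ)))]
    {I : Ideal R} (hI : I ≠ ⊤) : ∃ γ i, coord (ρ γ) i ∉ I := by
  by_contra! hcon
  have : Module.Finite R (Algebra.adjoin R (Set.range ρ)) :=
    Module.finite_of_finrank_pos (by omega)
  let b := Module.finBasisOfFinrankEq R (Algebra.adjoin R (Set.range ρ)) h
  have hle : Algebra.adjoin R (Set.range ρ) ≤ scalarMod I := by
    refine Algebra.adjoin_le ?_
    rintro _ ⟨γ, rfl⟩
    exact hcon γ
  -- a retraction onto the direct summand `R[ρ(Γ)]`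
  obtain ⟨s, hs⟩ := Module.projective_lifting_property
    (Submodule.mkQ (Subalgebra.toSubmodule (Algebra.adjoin R (Set.range ρ)))) LinearMap.id
    (Submodule.mkQ_surjective _)
  let p : Matrix (Fin 2) (Fin 2) R →ₗ[R] Algebra.adjoin R (Set.range ρ) :=
    LinearMap.codRestrict (Subalgebra.toSubmodule (Algebra.adjoin R (Set.range ρ)))
      (LinearMap.id - s.comp (Submodule.mkQ _)) fun X ↦ by
        refine (Submodule.Quotient.mk_eq_zero _).mp ?_
        rw [← Submodule.mkQ_apply, LinearMap.sub_apply, map_sub, sub_eq_zero]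
        exact congr($hs (Submodule.mkQ _ X)).symm
  have hp (X : Algebra.adjoin R (Set.range ρ)) : p X = X := by
    apply Subtype.ext
    have h0 : Submodule.mkQ (Subalgebra.toSubmodule (Algebra.adjoin R (Set.range ρ)))
        (X : Matrix (Fin 2) (Fin 2) R) = 0 := by
      rw [← LinearMap.mem_ker, Submodule.ker_mkQ]
      exact X.2
    change (X : Matrix (Fin 2) (Fin 2) R) - s (Submodule.mkQ _ (X : Matrix (Fin 2) (Fin 2) R)) = X
    rw [h0, map_zero, sub_zero]
  -- modulo `I`, every element of `R[ρ(Γ)]` is a multiple of `1`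
  have key (X : Algebra.adjoin R (Set.range ρ)) (k : Fin 2) :
      b.repr X k - (X : Matrix (Fin 2) (Fin 2) R) 1 1 * b.repr 1 k ∈ I := by
    have hX := hle X.2
    have h0 : (X : Matrix (Fin 2) (Fin 2) R) 0 1 ∈ I := hX 0
    have h1 : (X : Matrix (Fin 2) (Fin 2) R) 1 0 ∈ I := hX 1
    have h2 : (X : Matrix (Fin 2) (Fin 2) R) 0 0 - (X : Matrix (Fin 2) (Fin 2) R) 1 1 ∈ I := hX 2
    have e : (X : Matrix (Fin 2) (Fin 2) R) =
        (X : Matrix (Fin 2) (Fin 2) R) 1 1 • ((1 : Algebra.adjoin R (Set.range ρ)) : Matrix _ _ R) +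
        (X : Matrix (Fin 2) (Fin 2) R) 0 1 • Matrix.single 0 1 1 +
        (X : Matrix (Fin 2) (Fin 2) R) 1 0 • Matrix.single 1 0 1 +
        ((X : Matrix (Fin 2) (Fin 2) R) 0 0 - (X : Matrix (Fin 2) (Fin 2) R) 1 1) •
          Matrix.single 0 0 1 := by
      ext i j
      fin_cases i <;> fin_cases j <;> simp [Matrix.single]
    have e' := congr(b.repr (p $e) k)
    simp only [map_add, map_smul, hp, Finsupp.add_apply, Finsupp.smul_apply, smul_eq_mul] at e'
    rw [e', add_assoc, add_assoc, add_sub_cancel_left]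
    exact add_mem (I.mul_mem_right _ h0) (add_mem (I.mul_mem_right _ h1) (I.mul_mem_right _ h2))
  set l0 := (b 0 : Matrix (Fin 2) (Fin 2) R) 1 1
  set l1 := (b 1 : Matrix (Fin 2) (Fin 2) R) 1 1
  set c0 := b.repr 1 0
  set c1 := b.repr 1 1
  have k00 : 1 - l0 * c0 ∈ I := by simpa using key (b 0) 0
  have k01 : l0 * c1 ∈ I := by simpa using key (b 0) 1
  have k11 : 1 - l1 * c1 ∈ I := by simpa using key (b 1) 1
  refine hI (I.eq_top_iff_one.mpr ?_)
  have : (1 : R) = (1 - l0 * c0) + l0 * c0 * (1 - l1 * c1) + c0 * l1 * (l0 * c1) := by ring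
  rw [this]
  exact add_mem (add_mem k00 (I.mul_mem_left _ k11)) (I.mul_mem_left _ k01)

lemma imageAlgebra_eq {T : Scheme.{u}} (ρ : RepOn Γ T) (U : T.Opens) :
    imageAlgebra ρ U = Algebra.adjoin Γ(T, U) (Set.range
      (mapRep (T.presheaf.map (homOfLE le_top).op).hom ρ : Γ →* Matrix (Fin 2) (Fin 2) Γ(T, U))) :=
  rfl

/-- The equations imply the mold conditions on an affine neighbourhood where some `ρ(α)` is nowhere
scalar. -/
lemma IsUnipotentRep.hasUnipotentMold {T : Scheme.{u}} {ρ : RepOn Γ T} (h : IsUnipotentRep ρ) :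
    HasUnipotentMold ρ := by
  intro x
  have hx : x ∈ ⨆ p : Γ × Fin 3, T.basicOpen (coord (ρ p.1) p.2) := by
    rw [h.iSup_basicOpen]; trivial
  obtain ⟨⟨α, i⟩, hp⟩ := TopologicalSpace.Opens.mem_iSup.mp hx
  obtain ⟨U, hU, hxU, hUle⟩ := exists_isAffineOpen_mem_and_subset hp
  refine ⟨U, hU, hxU, ?_⟩
  have : Nontrivial Γ(T, U) := by
    have : Nonempty U := ⟨⟨x, hxU⟩⟩
    infer_instance
  set f := (T.presheaf.map (homOfLE (le_top : U ≤ ⊤)).op).hom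
  have h2 : IsUnit (2 : Γ(T, U)) := by
    have := h.isUnit_two.map f
    rwa [map_ofNat] at this
  have hm (g r) : minor (mapRep f ρ) g r = 0 := by rw [map_minor, h.minor_eq_zero, map_zero]
  have hd (γ) : disc (mapRep f ρ γ) = 0 :=
    (map_disc f (ρ γ)).trans (by rw [h.disc_eq_zero, map_zero])
  have hu : IsUnit (coord (mapRep f ρ α) i) := by
    have h1 := (RingedSpace.isUnit_res_basicOpen T.toLocallyRingedSpace.toRingedSpace
      (coord (ρ α) i)).map (T.presheaf.map (homOfLE (show U ≤ T.basicOpen _ from hUle)).op).hom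
    have h2 : coord (mapRep f ρ α) i = f (coord (ρ α) i) := map_coord f (ρ α) i
    rw [h2]
    convert! h1
    exact congr($(T.presheaf.map_comp (homOfLE (T.basicOpen_le (coord (ρ α) i))).op
      (homOfLE (show U ≤ T.basicOpen _ from hUle)).op) _)
  rw [imageAlgebra_eq]
  obtain ⟨h3, h4⟩ := free_and_finrank_adjoin_range h2 hm hd hu
  refine ⟨h3, h4, free_quotient_adjoin_range h2 hm hd hu, fun s hs ↦ ?_⟩
  obtain ⟨a, b, rfl⟩ := (mem_adjoin_range_iff h2 hm hd hu s).mp hs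
  exact disc_smul_one_add h2 (hd α) a b

lemma HasUnipotentMold.isUnipotentRep {T : Scheme.{u}} (h2 : IsUnit (2 : Γ(T, ⊤)))
    {ρ : RepOn Γ T} (h : HasUnipotentMold ρ) : IsUnipotentRep ρ := by
  choose U hU hxU hfree hrank hquot hdisc using h
  have hloc {a : Γ(T, ⊤)}
      (ha : ∀ x, T.presheaf.map (homOfLE (le_top : U x ≤ ⊤)).op a = 0) : a = 0 :=
    TopCat.Sheaf.eq_of_locally_eq' T.sheaf U ⊤ (fun _ ↦ homOfLE le_top)
      (fun x _ ↦ TopologicalSpace.Opens.mem_iSup.mpr ⟨x, hxU x⟩) _ _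
      fun x ↦ (ha x).trans (map_zero (T.presheaf.map (homOfLE (le_top : U x ≤ ⊤)).op).hom).symm
  have hnt (x : T) : Nontrivial Γ(T, U x) := by
    have : Nonempty (U x) := ⟨⟨x, hxU x⟩⟩
    infer_instance
  have hmem (x : T) (γ : Γ) : mapRep (T.presheaf.map (homOfLE (le_top : U x ≤ ⊤)).op).hom ρ γ ∈
      imageAlgebra ρ (U x) := Algebra.subset_adjoin ⟨γ, rfl⟩
  refine ⟨h2, fun g r ↦ hloc fun x ↦ ?_, fun γ ↦ hloc fun x ↦ ?_, top_le_iff.mp fun x _ ↦ ?_⟩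
  · have := hfree x
    exact (map_minor (T.presheaf.map (homOfLE le_top).op).hom ρ g r).symm.trans
      (minor_eq_zero_of_finrank (Subalgebra.toSubmodule (imageAlgebra ρ (U x))) (hmem x)
        (hrank x) g r)
  · exact (map_disc (T.presheaf.map (homOfLE le_top).op).hom (ρ γ)).symm.trans
      (hdisc x _ (hmem x γ))
  · have h1 := hfree x
    have h3 := hquot x
    have h4 := hrank x
    rw [imageAlgebra_eq] at h1 h3 h4
    -- the functions on `U x` which vanish at `x`
    let I : Ideal Γ(T, U x) := (IsLocalRing.maximalIdeal (T.presheaf.stalk x)).comap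
      (T.presheaf.germ (U x) x (hxU x)).hom
    obtain ⟨γ, i, hγ⟩ := exists_coord_notMem h4 (I := I) (Ideal.comap_ne_top _ Ideal.IsPrime.ne_top')
    refine TopologicalSpace.Opens.mem_iSup.mpr ⟨(γ, i), ?_⟩
    rw [Scheme.mem_basicOpen _ _ x (show x ∈ (⊤ : T.Opens) from trivial)]
    by_contra hcon
    apply hγ
    rw [Ideal.mem_comap, IsLocalRing.mem_maximalIdeal, mem_nonunits_iff]
    convert! hcon
    have e : coord (mapRep (T.presheaf.map (homOfLE (le_top : U x ≤ ⊤)).op).hom ρ γ) i =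
        (T.presheaf.map (homOfLE (le_top : U x ≤ ⊤)).op).hom (coord (ρ γ) i) := map_coord _ _ _
    rw [e]
    exact T.presheaf.germ_res_apply (homOfLE (le_top : U x ≤ ⊤)) x (hxU x) _

lemma unipRing_hom_ext {f g : UnipRing Γ →+* R}
    (h : ∀ γ, f.mapMatrix (unipRep Γ γ) = g.mapMatrix (unipRep Γ γ)) : f = g := by
  apply Ideal.Quotient.ringHom_ext
  exact repRing_hom_ext h

lemma pointRep_injective {T : Scheme.{u}} {f g : T ⟶ RepUScheme Γ}
    (h : pointRep f = pointRep g) : f = g := by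
  rw [← cancel_mono (nonScalarLocus Γ).ι]
  apply ext_of_isAffine
  rw [← cancel_epi (Scheme.ΓSpecIso (.of (UnipRing Γ))).inv]
  refine CommRingCat.hom_ext (unipRing_hom_ext fun γ ↦ ?_)
  exact congr($h γ)

/-- `Rep₂(Γ)_u` represents the functor of representations with unipotent mold. -/
theorem bijOn_pointRep (T : Over SHalf.{u}) :
    Set.BijOn (fun f : T ⟶ RepU Γ ↦ pointRep f.left) Set.univ
      {ρ : RepOn Γ T.left | HasUnipotentMold ρ} := by
  refine ⟨fun f _ ↦ (isUnipotentRep_pointRep f.left).hasUnipotentMold, fun f _ g _ h ↦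
    Over.OverMorphism.ext (pointRep_injective h), fun ρ hρ ↦ ?_⟩
  have h := HasUnipotentMold.isUnipotentRep (isUnit_two_of_over T) hρ
  exact ⟨Over.homMk (toRepU ρ h) (Subsingleton.elim _ _), trivial, pointRep_toRepU ρ h⟩

end Mold

/-! ### The action of `PGL₂` -/

section RightAction

variable {Γ : Type u} [Monoid Γ]

lemma ringOfPoint_comp {T T' : Scheme.{u}} (g : T' ⟶ T) (f : T ⟶ RepUScheme Γ) :
    ringOfPoint (g ≫ f) = g.appTop.hom.comp (ringOfPoint f) := by
  simp only [ringOfPoint, Category.assoc, Scheme.Hom.comp_appTop, CommRingCat.hom_comp,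
    RingHom.comp_assoc]

lemma pointRep_comp {T T' : Scheme.{u}} (g : T' ⟶ T) (f : T ⟶ RepUScheme Γ) :
    pointRep (g ≫ f) = mapRep g.appTop.hom (pointRep f) := by
  rw [pointRep, pointRep, mapRep_mapRep, ringOfPoint_comp]

lemma mapAut_symm_mapMatrix {R R' : Type*} [CommRing R] [CommRing R'] (f : R →+* R')
    (φ : MatAut R) (X : Matrix (Fin 2) (Fin 2) R) :
    (mapAut f φ).symm (f.mapMatrix X) = f.mapMatrix (φ.symm X) := by
  rw [AlgEquiv.symm_apply_eq, mapAut_mapMatrix, AlgEquiv.apply_symm_apply]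

lemma mapRep_conjRep {R R' : Type*} [CommRing R] [CommRing R'] (f : R →+* R')
    (ρ : Γ →* Matrix (Fin 2) (Fin 2) R) (φ : MatAut R) :
    mapRep f (conjRep ρ φ) = conjRep (mapRep f ρ) (mapAut f φ) :=
  MonoidHom.ext fun γ ↦ (mapAut_symm_mapMatrix f φ (ρ γ)).symm

variable (Γ) in
lemma pointRep_actionU : pointRep (actionU Γ).left =
    conjRep (pointRep (fst (RepU Γ) PGL2.{u}).left) (pglAut (snd (RepU Γ) PGL2.{u}).left) :=
  pointRep_toRepU _ ((isUnipotentRep_pointRep _).conj _)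

lemma pointRep_comp_actionU {T : Over SHalf.{u}} (y : T ⟶ RepU Γ ⊗ PGL2.{u}) :
    pointRep (y ≫ actionU Γ).left =
      conjRep (pointRep (y ≫ fst _ _).left) (pglAut (y ≫ snd _ _).left) := by
  rw [Over.comp_left, Over.comp_left, Over.comp_left, pointRep_comp, pointRep_comp,
    ← mapAut_pglAut, ← mapRep_conjRep]
  rw [pointRep_actionU]

lemma pglAut_comp_one {T : Over SHalf.{u}} (y : T ⟶ 𝟙_ (Over SHalf.{u})) :
    pglAut (y ≫ MonObj.one (X := PGL2.{u})).left = 1 := by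
  have h : pglAut (MonObj.one (X := PGL2.{u})).left = 1 :=
    pglRepresentableBy.homEquiv.apply_symm_apply _
  rw [Over.comp_left, ← mapAut_pglAut, h, map_one]

lemma pglAut_comp_mul {T : Over SHalf.{u}} (y : T ⟶ PGL2.{u} ⊗ PGL2.{u}) :
    pglAut (y ≫ MonObj.mul (X := PGL2.{u})).left =
      pglAut (y ≫ fst _ _).left * pglAut (y ≫ snd _ _).left := by
  have h : pglAut (MonObj.mul (X := PGL2.{u})).left =
      pglAut (fst PGL2.{u} PGL2.{u}).left * pglAut (snd PGL2.{u} PGL2.{u}).left :=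
    pglRepresentableBy.homEquiv.apply_symm_apply _
  rw [Over.comp_left, Over.comp_left, Over.comp_left, ← mapAut_pglAut, h, map_mul, mapAut_pglAut,
    mapAut_pglAut]

lemma conjRep_one {R : Type*} [CommRing R] (ρ : Γ →* Matrix (Fin 2) (Fin 2) R) :
    conjRep ρ 1 = ρ := rfl

lemma conjRep_mul {R : Type*} [CommRing R] (ρ : Γ →* Matrix (Fin 2) (Fin 2) R)
    (φ ψ : MatAut R) : conjRep ρ (φ * ψ) = conjRep (conjRep ρ φ) ψ := rfl

variable (Γ) in
/-- On points the two axioms read `1⁻¹ ∘ ρ = ρ` and `(φψ)⁻¹ ∘ ρ = ψ⁻¹ ∘ (φ⁻¹ ∘ ρ)`. -/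
theorem isRightAction_actionU : IsRightAction (actionU Γ) where
  one := by
    refine Over.OverMorphism.ext (pointRep_injective ?_)
    rw [pointRep_comp_actionU]
    rw [whiskerLeft_fst, whiskerLeft_snd, pglAut_comp_one, conjRep_one, rightUnitor_hom]
  mul := by
    refine Over.OverMorphism.ext (pointRep_injective ?_)
    rw [pointRep_comp_actionU, whiskerRight_fst, whiskerRight_snd, pointRep_comp_actionU,
      ← Category.assoc, pointRep_comp_actionU, Category.assoc, Category.assoc, whiskerLeft_fst,
      whiskerLeft_snd, ← Category.assoc, pglAut_comp_mul, conjRep_mul, associator_hom_fst,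
      Category.assoc, Category.assoc, associator_hom_snd_fst, associator_hom_snd_snd]

end RightAction

/-! ### Invariance of the morphism to `Ch₂(Γ)_u` -/

section Invariance

variable {Γ : Type u} [Monoid Γ]

lemma isUnit_appTop_of_le {T : Scheme.{u}} {U : T.Opens} {c : Γ(T, ⊤)} (h : U ≤ T.basicOpen c) :
    IsUnit (U.ι.appTop.hom c) := by
  refine RingedSpace.isUnit_of_isUnit_germ _ _ _ fun x hx ↦ ?_
  rw [← RingedSpace.mem_basicOpen]
  have h1 : U.ι ⁻¹ᵁ T.basicOpen c = U.toScheme.basicOpen (U.ι.appTop c) :=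
    Scheme.preimage_basicOpen_top U.ι c
  exact h1.le (h x.2)

lemma isUnit_coord_mapRep_of_le {T : Scheme.{u}} {U : T.Opens} {ρ : RepOn Γ T} {α : Γ} {i : Fin 3}
    (h : U ≤ T.basicOpen (coord (ρ α) i)) : IsUnit (coord (mapRep U.ι.appTop.hom ρ α) i) := by
  have e : coord (mapRep U.ι.appTop.hom ρ α) i = U.ι.appTop.hom (coord (ρ α) i) :=
    map_coord U.ι.appTop.hom (ρ α) i
  rw [e]
  exact isUnit_appTop_of_le h

lemma IsUnipotentRep.exists_mem_basicOpen {T : Scheme.{u}} {ρ : RepOn Γ T} (h : IsUnipotentRep ρ)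
    (t : T) : ∃ α i, t ∈ T.basicOpen (coord (ρ α) i) := by
  have ht : t ∈ ⨆ p : Γ × Fin 3, T.basicOpen (coord (ρ p.1) p.2) := by
    rw [h.iSup_basicOpen]; trivial
  obtain ⟨⟨α, i⟩, hp⟩ := TopologicalSpace.Opens.mem_iSup.mp ht
  exact ⟨α, i, hp⟩

/-- The morphism to `Ch₂(Γ)_u` attached to a representation is compatible with pullback. -/
lemma comp_toChU {T T' : Scheme.{u}} (p : T' ⟶ T) {ρ : RepOn Γ T} (h : IsUnipotentRep ρ)
    {ρ' : RepOn Γ T'} (hρ : mapRep p.appTop.hom ρ = ρ') (h2 : IsUnit (2 : Γ(T', ⊤)))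
    (hm : ∀ g r, minor ρ' g r = 0) (hd : ∀ γ, disc (ρ' γ) = 0) {α : Γ} {i : Fin 3}
    (hu : IsUnit (coord (ρ' α) i)) : p ≫ toChU ρ h = chPoint ρ' h2 hm hd hu := by
  have hV : p ⁻¹ᵁ T.basicOpen (coord (ρ α) i) = ⊤ := by
    have e : coord (mapRep p.appTop.hom ρ α) i = p.appTop.hom (coord (ρ α) i) :=
      map_coord p.appTop.hom (ρ α) i
    rw [Scheme.preimage_basicOpen_top]
    refine Scheme.basicOpen_of_isUnit _ ?_
    rw [← hρ, e] at hu
    exact hu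
  let l : T' ⟶ (T.basicOpen (coord (ρ α) i)).toScheme :=
    IsOpenImmersion.lift (T.basicOpen (coord (ρ α) i)).ι p (by
      rw [Scheme.Opens.range_ι]
      rintro _ ⟨x, rfl⟩
      exact hV.ge (show x ∈ (⊤ : T'.Opens) from trivial))
  have hl : l ≫ (T.basicOpen (coord (ρ α) i)).ι = p := IsOpenImmersion.lift_fac _ _ _
  have hι : (T.basicOpen (coord (ρ α) i)).ι ≫ toChU ρ h = _ :=
    Scheme.Cover.ι_glueMorphisms (T.openCoverOfIsOpenCover
      (fun p : Γ × Fin 3 ↦ T.basicOpen (coord (ρ p.1) p.2)) h.iSup_basicOpen) _ _ (α, i)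
  rw [← hl, Category.assoc, hι]
  refine comp_chPoint l _ _ _ _ ?_ h2 hm hd hu
  refine (mapRep_mapRep _ _ ρ).trans ?_
  rw [← hρ, ← CommRingCat.hom_comp, ← Scheme.Hom.comp_appTop]
  exact congr(mapRep (Scheme.Hom.appTop $hl).hom ρ)

/-- On points, `π` is given by `chPoint`, wherever some `ρ(α)` is nowhere scalar. -/
lemma comp_piU {T : Scheme.{u}} (f : T ⟶ RepUScheme Γ) {ρ : RepOn Γ T} (hρ : pointRep f = ρ)
    (h2 : IsUnit (2 : Γ(T, ⊤))) (hm : ∀ g r, minor ρ g r = 0) (hd : ∀ γ, disc (ρ γ) = 0)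
    {α : Γ} {i : Fin 3} (hu : IsUnit (coord (ρ α) i)) :
    f ≫ (piU Γ).left = chPoint ρ h2 hm hd hu := by
  refine comp_toChU f (isUnipotentRep_pointRep _) ?_ h2 hm hd hu
  rw [← pointRep_comp, Category.comp_id, hρ]

/-- The morphism `chPoint` depends only on the character and on the derivation. -/
lemma chPoint_congr {X : Scheme.{u}} {ρ ρ' : RepOn Γ X} (h2 : IsUnit (2 : Γ(X, ⊤)))
    (hm : ∀ g r, minor ρ g r = 0) (hd : ∀ γ, disc (ρ γ) = 0) (hm' : ∀ g r, minor ρ' g r = 0)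
    (hd' : ∀ γ, disc (ρ' γ) = 0) {α : Γ} {i j : Fin 3} (hu : IsUnit (coord (ρ α) i))
    (hv : IsUnit (coord (ρ' α) j)) (htr : ∀ γ, (ρ γ).trace = (ρ' γ).trace)
    (ha : ∀ γ, derivOf ρ' hv γ = derivOf ρ hu γ) :
    chPoint ρ h2 hm hd hu = chPoint ρ' h2 hm' hd' hv := by
  unfold chPoint
  refine projPoint_scale _ _ _ 1 (fun n x hx ↦ chHom_scale 1 (fun γ ↦ ?_) (fun γ ↦ ?_) n x hx) _ _ _ _
  · rw [unipHom, unipHom, chHom_algebraMap, chHom_algebraMap, charHom_univChar, charHom_univChar]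
    change halfTrace h2 _ = halfTrace h2 _
    rw [halfTrace, htr, halfTrace]
  · rw [unipHom, unipHom, chHom_symD, chHom_symD, one_mul, ha]

lemma derivOf_mul_coord {R : Type u} [CommRing R] (ρ : Γ →* Matrix (Fin 2) (Fin 2) R) {α : Γ}
    {i : Fin 3} (hu : IsUnit (coord (ρ α) i)) (γ : Γ) :
    derivOf ρ hu γ * coord (ρ α) i = coord (ρ γ) i := by
  rw [derivOf, mul_assoc, hu.val_inv_mul, mul_one]

lemma derivOf_conjRep {R : Type u} [CommRing R] {ρ : Γ →* Matrix (Fin 2) (Fin 2) R}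
    (h2 : IsUnit (2 : R)) (hm : ∀ g r, minor ρ g r = 0) (φ : MatAut R) {α : Γ} {i j : Fin 3}
    (hu : IsUnit (coord (ρ α) i)) (hv : IsUnit (coord (conjRep ρ φ α) j)) (γ : Γ) :
    derivOf (conjRep ρ φ) hv γ = derivOf ρ hu γ := by
  have key (γ : Γ) : coord (conjRep ρ φ γ) j =
      derivOf ρ hu γ * coord (φ.symm (eta h2 (ρ α))) j := by
    rw [conjRep_apply, rep_eq h2 hm hu γ, map_add, map_smul, map_smul, map_one, coord_smul_one_add]
    rfl
  apply hv.mul_right_cancel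
  rw [derivOf_mul_coord, key γ, key α, derivOf_self, one_mul]

lemma hom_ext_of_locally {T Z : Scheme.{u}} {f g : T ⟶ Z}
    (h : ∀ t : T, ∃ U : T.Opens, t ∈ U ∧ U.ι ≫ f = U.ι ≫ g) : f = g := by
  choose U hU h using h
  exact (T.openCoverOfIsOpenCover U (TopologicalSpace.IsOpenCover.mk (top_le_iff.mp fun t _ ↦
      TopologicalSpace.Opens.mem_iSup.mpr ⟨t, hU t⟩))).hom_ext _ _ h

/-- Where `ρ(α)` is not scalar, none of its conjugates is. -/
lemma exists_mem_basicOpen_coord_conjRep {T : Scheme.{u}} {ρ : RepOn Γ T} (φ : MatAut Γ(T, ⊤))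
    {t : T} {α : Γ} {i : Fin 3} (ht : t ∈ T.basicOpen (coord (ρ α) i)) :
    ∃ j, t ∈ T.basicOpen (coord (conjRep ρ φ α) j) := by
  have h1 := coord_matAut φ (conjRep ρ φ α) i
  rw [conjRep_apply, φ.apply_symm_apply] at h1
  rw [h1] at ht
  have h3 {a b : Γ(T, ⊤)} (h : t ∈ T.basicOpen (a * b)) : t ∈ T.basicOpen a := by
    rw [Scheme.basicOpen_mul] at h
    exact h.1
  obtain (ht | ht) := Scheme.basicOpen_add_le _ _ _ ht
  · obtain (ht | ht) := Scheme.basicOpen_add_le _ _ _ ht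
    · exact ⟨0, h3 ht⟩
    · exact ⟨1, h3 ht⟩
  · exact ⟨2, h3 ht⟩

variable (Γ) in
/-- Conjugation changes neither the character nor the derivation. -/
theorem actionU_comp_piU : actionU Γ ≫ piU Γ = fst (RepU Γ) PGL2.{u} ≫ piU Γ := by
  refine Over.OverMorphism.ext (hom_ext_of_locally fun t ↦ ?_)
  rw [Over.comp_left, Over.comp_left]
  set ρ : RepOn Γ (RepU Γ ⊗ PGL2.{u}).left := pointRep (fst (RepU Γ) PGL2.{u}).left
  set φ := pglAut (snd (RepU Γ) PGL2.{u}).left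
  have hσ : pointRep (actionU Γ).left = conjRep ρ φ := pointRep_actionU Γ
  have h : IsUnipotentRep ρ := isUnipotentRep_pointRep _
  obtain ⟨α, i, hi⟩ := h.exists_mem_basicOpen t
  obtain ⟨j, hj⟩ := exists_mem_basicOpen_coord_conjRep φ hi
  let U : (RepU Γ ⊗ PGL2.{u}).left.Opens := (RepU Γ ⊗ PGL2.{u}).left.basicOpen (coord (ρ α) i) ⊓
    (RepU Γ ⊗ PGL2.{u}).left.basicOpen (coord (conjRep ρ φ α) j)
  refine ⟨U, ⟨hi, hj⟩, ?_⟩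
  have h2 := isUnit_two_map U.ι h.isUnit_two
  have hm := mapRep_minor U.ι h.minor_eq_zero
  have hd := mapRep_disc U.ι h.disc_eq_zero
  have hm' := mapRep_minor U.ι (h.conj φ).minor_eq_zero
  have hd' := mapRep_disc U.ι (h.conj φ).disc_eq_zero
  have hu : IsUnit (coord (mapRep U.ι.appTop.hom ρ α) i) := isUnit_coord_mapRep_of_le inf_le_left
  have hv : IsUnit (coord (mapRep U.ι.appTop.hom (conjRep ρ φ) α) j) :=
    isUnit_coord_mapRep_of_le inf_le_right
  rw [← Category.assoc, ← Category.assoc,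
    comp_piU (U.ι ≫ (actionU Γ).left) (by rw [pointRep_comp, hσ]) h2 hm' hd' hv,
    comp_piU (U.ι ≫ (fst (RepU Γ) PGL2.{u}).left) (by rw [pointRep_comp]) h2 hm hd hu]
  symm
  refine chPoint_congr h2 hm hd hm' hd' hu hv (fun γ ↦ ?_) fun γ ↦ ?_
  · rw [mapRep_conjRep, conjRep_apply, trace_matAut h2]
  · revert hv
    rw [mapRep_conjRep]
    exact fun hv ↦ derivOf_conjRep h2 hm _ hu hv γ

end Invariance

/-! ### Local sections -/

noncomputable section LocalSections

variable {Γ : Type u} [Monoid Γ]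

/-- The representation `γ ↦ [[r(γ), a(γ)], [0, r(γ)]]` attached to a character `r` and a derivation
`a` with respect to `r`. -/
def upperRep {R : Type*} [CommRing R] (r : Γ →* R) (a : Γ → R)
    (ha : ∀ γ δ, a (γ * δ) = r γ * a δ + a γ * r δ) : Γ →* Matrix (Fin 2) (Fin 2) R where
  toFun γ := r γ • 1 + a γ • Matrix.single 0 1 1
  map_one' := by
    have h : a 1 = 0 := by
      have := ha 1 1
      simp only [map_one, mul_one, one_mul] at this
      linear_combination -this
    rw [map_one, one_smul, h, zero_smul, add_zero]
  map_mul' γ δ := by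
    simp only [add_mul, mul_add, smul_mul_smul_comm, mul_one, one_mul, map_mul, ha, add_smul,
      Matrix.single_mul_single_of_ne _ _ _ _ (show (1 : Fin 2) ≠ 0 by decide), smul_zero]
    abel

section
variable {R : Type*} [CommRing R] (r : Γ →* R) (a : Γ → R)
    (ha : ∀ γ δ, a (γ * δ) = r γ * a δ + a γ * r δ)

lemma upperRep_apply (γ : Γ) :
    upperRep r a ha γ = r γ • 1 + a γ • Matrix.single 0 1 1 := rfl

lemma trace_upperRep (γ : Γ) : (upperRep r a ha γ).trace = 2 * r γ := by
  simp [upperRep_apply, Matrix.trace_fin_two, Matrix.single]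
  ring

lemma coord_upperRep (γ : Γ) : coord (upperRep r a ha γ) 0 = a γ := by
  simp [upperRep_apply, coord]

lemma disc_upperRep (γ : Γ) : disc (upperRep r a ha γ) = 0 := by
  simp [upperRep_apply, disc, Matrix.trace_fin_two, Matrix.det_fin_two, Matrix.single]
  ring

lemma minor_upperRep (g : Fin 3 → Γ) (s : Fin 3 → Fin 2 × Fin 2) :
    minor (upperRep r a ha) g s = 0 := by
  rw [minor, Matrix.det_fin_three]
  simp only [Matrix.of_apply, upperRep_apply, Matrix.add_apply, Matrix.smul_apply, smul_eq_mul]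
  ring

end

lemma univChar_one : univChar Γ 1 = 1 := by
  rw [univChar, map_one, Matrix.one_apply_eq]

lemma univChar_mul (γ δ : Γ) : univChar Γ (γ * δ) = univChar Γ γ * univChar Γ δ := by
  rw [univChar, map_mul, Matrix.mul_apply, Fin.sum_univ_one]
  rfl

lemma symD_mul (γ δ : Γ) : symD (γ * δ) =
    algebraMap _ _ (univChar Γ γ) * symD δ + algebraMap _ _ (univChar Γ δ) * symD γ := by
  have h : omegaD (γ * δ) = univChar Γ γ • omegaD δ + univChar Γ δ • omegaD γ := by
    have h0 : (omegaRel Γ).mkQ (univChar Γ γ • Finsupp.single δ 1 +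
        univChar Γ δ • Finsupp.single γ 1 - Finsupp.single (γ * δ) 1) = 0 :=
      (Submodule.Quotient.mk_eq_zero _).mpr (Submodule.subset_span ⟨γ, δ, rfl⟩)
    rw [map_sub, map_add, map_smul, map_smul, sub_eq_zero] at h0
    exact h0.symm
  rw [symD, h, map_add, map_smul, map_smul, Algebra.smul_def, Algebra.smul_def]
  rfl

/-- The open subsets `D₊(dγ)` cover `Ch₂(Γ)_u`. -/
lemma iSup_basicOpen_symD :
    ⨆ γ : Γ, Proj.basicOpen (symGrading (RepRing 1 Γ) (Omega Γ)) (symD γ) = ⊤ := by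
  refine Proj.iSup_basicOpen_eq_top' _ _ (fun γ ↦ ⟨1, symD_mem γ⟩) (top_le_iff.mp fun x _ ↦ ?_)
  have halg (c : RepRing 1 Γ) : algebraMap _ (SymmetricAlgebra (RepRing 1 Γ) (Omega Γ)) c ∈
      Algebra.adjoin (symGrading (RepRing 1 Γ) (Omega Γ) 0) (Set.range (symD (Γ := Γ))) :=
    Subalgebra.algebraMap_mem _ (algebraMap _ (symGrading (RepRing 1 Γ) (Omega Γ) 0) c)
  induction x using SymmetricAlgebra.induction with
  | algebraMap c => exact halg c
  | ι m =>
    induction m using omega_induction with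
    | h0 => rw [map_zero]; exact zero_mem _
    | hadd x y hx hy => rw [map_add]; exact add_mem (hx trivial) (hy trivial)
    | hsmul c γ =>
      rw [map_smul, Algebra.smul_def]
      exact mul_mem (halg c) (Algebra.subset_adjoin ⟨γ, rfl⟩)
  | mul a b ha hb => exact mul_mem (ha trivial) (hb trivial)
  | add a b ha hb => exact add_mem (ha trivial) (hb trivial)

/-- The coordinate ring of `D₊(dα)`. -/
abbrev ChAway (α : Γ) : Type u :=
  HomogeneousLocalization.Away (symGrading (RepRing 1 Γ) (Omega Γ)) (symD α)

/-- The universal character over `D₊(dα)`. -/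
def awayChar (α : Γ) : Γ →* ChAway α where
  toFun γ := HomogeneousLocalization.fromZeroRingHom (symGrading (RepRing 1 Γ) (Omega Γ)) _
    (algebraMap _ (symGrading (RepRing 1 Γ) (Omega Γ) 0) (univChar Γ γ))
  map_one' := by rw [univChar_one, map_one, map_one]
  map_mul' γ δ := by rw [univChar_mul, map_mul, map_mul]

/-- The function `dγ/dα` on `D₊(dα)`. -/
def awayD (α γ : Γ) : ChAway α :=
  HomogeneousLocalization.Away.mk _ (symD_mem α) 1 (symD γ) (symD_mem γ)

lemma val_awayChar (α γ : Γ) : (awayChar α γ).val =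
    algebraMap _ (Localization.Away (symD α))
      (algebraMap _ (SymmetricAlgebra (RepRing 1 Γ) (Omega Γ)) (univChar Γ γ)) :=
  Localization.mk_one_eq_algebraMap _

lemma val_awayMk_mul (α : Γ) (n : ℕ) (x : SymmetricAlgebra (RepRing 1 Γ) (Omega Γ))
    (hx : x ∈ symGrading (RepRing 1 Γ) (Omega Γ) (n • 1)) :
    (HomogeneousLocalization.Away.mk _ (symD_mem α) n x hx).val *
      algebraMap _ (Localization.Away (symD α)) (symD α) ^ n =
      algebraMap _ (Localization.Away (symD α)) x := by
  rw [HomogeneousLocalization.Away.val_mk, Localization.mk_eq_mk', ← map_pow]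
  exact IsLocalization.mk'_spec (Localization.Away (symD α)) x ⟨symD α ^ n, _⟩

lemma val_awayD_mul (α γ : Γ) :
    (awayD α γ).val * algebraMap _ (Localization.Away (symD α)) (symD α) =
      algebraMap _ (Localization.Away (symD α)) (symD γ) := by
  have := val_awayMk_mul α 1 (symD γ) (symD_mem γ)
  rwa [pow_one] at this

lemma isUnit_algebraMap_symD (α : Γ) :
    IsUnit (algebraMap _ (Localization.Away (symD α)) (symD α)) :=
  IsLocalization.Away.algebraMap_isUnit (symD α)

lemma awayD_self (α : Γ) : awayD α α = 1 := by
  apply HomogeneousLocalization.val_injective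
  apply (isUnit_algebraMap_symD α).mul_right_cancel
  rw [val_awayD_mul, HomogeneousLocalization.val_one, one_mul]

lemma awayD_mul (α γ δ : Γ) :
    awayD α (γ * δ) = awayChar α γ * awayD α δ + awayD α γ * awayChar α δ := by
  apply HomogeneousLocalization.val_injective
  apply (isUnit_algebraMap_symD α).mul_right_cancel
  rw [val_awayD_mul, HomogeneousLocalization.val_add, HomogeneousLocalization.val_mul,
    HomogeneousLocalization.val_mul, add_mul, mul_assoc, val_awayD_mul, mul_right_comm,
    val_awayD_mul, val_awayChar, val_awayChar, symD_mul, map_add, map_mul, map_mul]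
  ring

lemma isUnit_two_chAway (α : Γ) : IsUnit (2 : ChAway α) := by
  have h := isUnit_two_zHalf.{u}.map ((HomogeneousLocalization.fromZeroRingHom
    (symGrading (RepRing 1 Γ) (Omega Γ)) (Submonoid.powers (symD α))).comp
      ((algebraMap (RepRing 1 Γ) (symGrading (RepRing 1 Γ) (Omega Γ) 0)).comp
        (algebraMap ZHalf.{u} (RepRing 1 Γ))))
  rwa [map_ofNat] at h

/-- A homomorphism out of `S(Ω_Γ)` which agrees with the universal character and derivation over
`D₊(dα)` induces the identity of the coordinate ring of `D₊(dα)`. -/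
lemma awayLift_eq_of_eq {α : Γ} {R : Type u} [CommRing R] (e : ChAway α ≃+* R)
    {f : SymmetricAlgebra (RepRing 1 Γ) (Omega Γ) →+* R}
    (h0 : ∀ γ, f (algebraMap _ _ (univChar Γ γ)) = e (awayChar α γ))
    (h1 : ∀ γ, f (symD γ) = e (awayD α γ)) (hf : IsUnit (f (symD α))) :
    awayLift (symGrading (RepRing 1 Γ) (Omega Γ)) f (symD α) hf = e := by
  -- a degree `n` element `x` is sent to `e (x / (dα)ⁿ)`, as one sees in degree `1`
  let val := algebraMap (ChAway α) (Localization.Away (symD α))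
  have key := chHom_scale (f := val.comp (e.symm.toRingHom.comp f))
    (g := algebraMap _ (Localization.Away (symD α))) (algebraMap _ _ (symD α))
    (fun γ ↦ by
      change (e.symm (f _)).val = _
      rw [h0, e.symm_apply_apply, val_awayChar])
    (fun γ ↦ by
      change _ = _ * (e.symm (f _)).val
      rw [h1, e.symm_apply_apply, mul_comm, val_awayD_mul])
  ext z
  obtain ⟨n, x, hx, rfl⟩ :=
    HomogeneousLocalization.Away.mk_surjective (symGrading (RepRing 1 Γ) (Omega Γ)) (symD_mem α) z
  apply (hf.pow n).mul_right_cancel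
  rw [awayLift_mk, h1, awayD_self, map_one, one_pow, mul_one]
  apply e.symm.injective
  apply HomogeneousLocalization.val_injective
  apply ((isUnit_algebraMap_symD α).pow n).mul_right_cancel
  have h := key n x (by simpa using hx)
  rw [RingHom.coe_coe, e.symm_apply_apply, val_awayMk_mul, h, mul_comm]
  rfl

variable (Γ) in
/-- Over `D₊(dα)`, the matrices `[[χ(γ), dγ/dα], [0, χ(γ)]]` define a section of `π`. -/
theorem hasLocalSections_piU : HasLocalSections (piU Γ) := by
  intro y
  have hy : y ∈ ⨆ γ : Γ, Proj.basicOpen (symGrading (RepRing 1 Γ) (Omega Γ)) (symD γ) := by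
    rw [iSup_basicOpen_symD]; trivial
  obtain ⟨α, hy⟩ := TopologicalSpace.Opens.mem_iSup.mp hy
  let j := Proj.awayι (symGrading (RepRing 1 Γ) (Omega Γ)) (symD α) (symD_mem α) one_pos
  let T : Scheme.{u} := Spec (.of (ChAway α))
  let e : ChAway α ≃+* Γ(T, ⊤) := (Scheme.ΓSpecIso (.of (ChAway α))).symm.commRingCatIsoToRingEquiv
  have h2 : IsUnit (2 : Γ(T, ⊤)) := by
    have := (isUnit_two_chAway α).map e
    rwa [map_ofNat] at this
  let ρ₀ := upperRep (awayChar α) (awayD α) (awayD_mul α)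
  let ρ : RepOn Γ T := mapRep e.toRingHom ρ₀
  have hm (g r) : minor ρ g r = 0 := by rw [map_minor, minor_upperRep, map_zero]
  have hd (γ) : disc (ρ γ) = 0 :=
    (map_disc e.toRingHom (ρ₀ γ)).trans (by rw [disc_upperRep, map_zero])
  have hc (γ) : coord (ρ γ) 0 = e (awayD α γ) :=
    (map_coord e.toRingHom (ρ₀ γ) 0).trans (congrArg e (coord_upperRep ..))
  have hu : IsUnit (coord (ρ α) 0) := by
    rw [hc, awayD_self, map_one]
    exact isUnit_one
  have h : IsUnipotentRep ρ := ⟨h2, hm, hd, top_le_iff.mp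
    ((Scheme.basicOpen_of_isUnit _ hu).ge.trans
      (le_iSup (fun p : Γ × Fin 3 ↦ T.basicOpen (coord (ρ p.1) p.2)) (α, 0)))⟩
  have hs : toRepU ρ h ≫ (piU Γ).left = j := by
    rw [comp_piU _ (pointRep_toRepU ρ h) h2 hm hd hu, chPoint, projPoint,
      awayLift_eq_of_eq e (fun γ ↦ ?_) fun γ ↦ ?_]
    · exact toSpecΓ_SpecMap_ΓSpecIso_inv_assoc _ _
    · rw [unipHom, chHom_algebraMap, charHom_univChar]
      apply h2.mul_left_cancel
      refine (two_mul_halfTrace h2 _).trans ?_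
      trans e (ρ₀ γ).trace
      · simp [ρ, mapRep, Matrix.trace_fin_two]
      · rw [trace_upperRep, map_mul, map_ofNat]
    · rw [unipHom, chHom_symD]
      apply hu.mul_right_cancel
      rw [derivOf_mul_coord, hc, hc, awayD_self, map_one, mul_one]
  refine ⟨j.opensRange, j.isoOpensRange.inv ≫ toRepU ρ h, ?_, ?_⟩
  · exact (Proj.opensRange_awayι _ _ (symD_mem α) one_pos).ge hy
  · rw [Category.assoc, hs, Scheme.Hom.isoOpensRange_inv_comp]

end LocalSections

/-! ### Local conjugacy -/

section Conjugacy

section Proj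
variable {A : Type u} [CommRing A] {σ : Type*} [SetLike σ A] [AddSubgroupClass σ A]
  (𝒜 : ℕ → σ) [GradedRing 𝒜] {X : Scheme.{u}}

lemma isUnit_of_basicOpen_eq_top {c : Γ(X, ⊤)} (h : X.basicOpen c = ⊤) : IsUnit c := by
  refine RingedSpace.isUnit_of_isUnit_germ _ _ _ fun x hx ↦ ?_
  rw [← RingedSpace.mem_basicOpen]
  exact h.ge hx

lemma projPoint_preimage_basicOpen (f : A →+* Γ(X, ⊤)) {t : A} {d : ℕ} (ht : t ∈ 𝒜 d)
    (hd : 0 < d) (h : IsUnit (f t)) {s : A} {e : ℕ} (hs : s ∈ 𝒜 e) (he : 0 < e) :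
    projPoint 𝒜 f ht hd h ⁻¹ᵁ Proj.basicOpen 𝒜 s = X.basicOpen (f s) := by
  have e1 : awayLift 𝒜 f t h (HomogeneousLocalization.Away.isLocalizationElem ht hs) * f t ^ e =
      f s ^ d := by
    rw [awayLift_mk, map_pow]
  have e2 : X.basicOpen (f s) = X.basicOpen
      (awayLift 𝒜 f t h (HomogeneousLocalization.Away.isLocalizationElem ht hs)) := by
    rw [← X.basicOpen_pow (f s) hd, ← e1, Scheme.basicOpen_mul,
      Scheme.basicOpen_of_isUnit _ (h.pow e), inf_top_eq]
  rw [e2, ← Scheme.toSpecΓ_preimage_basicOpen]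
  unfold projPoint
  rw [Scheme.Hom.comp_preimage, Scheme.Hom.comp_preimage,
    Proj.awayι_preimage_basicOpen 𝒜 ht hd hs he]
  rfl

lemma projPoint_injective {f g : A →+* Γ(X, ⊤)} {t : A} {d : ℕ} (ht : t ∈ 𝒜 d) (hd : 0 < d)
    (hf : IsUnit (f t)) (hg : IsUnit (g t))
    (h : projPoint 𝒜 f ht hd hf = projPoint 𝒜 g ht hd hg) :
    awayLift 𝒜 f t hf = awayLift 𝒜 g t hg := by
  unfold projPoint at h
  rw [← Category.assoc, ← Category.assoc, cancel_mono] at h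
  have key (φ : HomogeneousLocalization.Away 𝒜 t →+* Γ(X, ⊤)) :
      ((Scheme.ΓSpecIso (.of (HomogeneousLocalization.Away 𝒜 t))).inv ≫
        (X.toSpecΓ ≫ Spec.map (CommRingCat.ofHom φ)).appTop).hom = φ := by
    simp
  rw [← key (awayLift 𝒜 f t hf), h, key]

/-- If two morphisms to `Proj` agree, they have the same coordinates in the chart `D₊(s)` through
which the first one factors. -/
lemma projPoint_eq_projPoint {f g : A →+* Γ(X, ⊤)} {s t : A} {d e : ℕ} (hs : s ∈ 𝒜 d) (hd : 0 < d)
    (ht : t ∈ 𝒜 e) (he : 0 < e) (hf : IsUnit (f s)) (hg : IsUnit (g t))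
    (h : projPoint 𝒜 f hs hd hf = projPoint 𝒜 g ht he hg) :
    ∃ hg' : IsUnit (g s), awayLift 𝒜 f s hf = awayLift 𝒜 g s hg' := by
  have h1 : IsUnit (g s) := by
    apply isUnit_of_basicOpen_eq_top
    rw [← projPoint_preimage_basicOpen 𝒜 g ht he hg hs hd, ← h,
      projPoint_preimage_basicOpen 𝒜 f hs hd hf hs hd, Scheme.basicOpen_of_isUnit _ hf]
  refine ⟨h1, projPoint_injective 𝒜 hs hd hf h1 (h.trans ?_)⟩
  have h2 : IsUnit (g (s * t)) := by rw [map_mul]; exact h1.mul hg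
  have h3 : IsUnit (g (t * s)) := by rwa [mul_comm]
  rw [← projPoint_mul 𝒜 g ht he hs hg h3, ← projPoint_mul 𝒜 g hs hd ht h1 h2]
  congr 1
  · exact mul_comm _ _
  · exact add_comm _ _

end Proj

variable {Γ : Type u} [Monoid Γ]

/-- The morphism `chPoint` determines the character, and the derivation up to a unit. -/
lemma trace_eq_and_derivOf_eq_of_chPoint_eq {X : Scheme.{u}} {ρ ρ' : RepOn Γ X}
    (h2 : IsUnit (2 : Γ(X, ⊤)))
    (hm : ∀ g r, minor ρ g r = 0) (hd : ∀ γ, disc (ρ γ) = 0) (hm' : ∀ g r, minor ρ' g r = 0)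
    (hd' : ∀ γ, disc (ρ' γ) = 0) {α β : Γ} {i j : Fin 3} (hu : IsUnit (coord (ρ α) i))
    (hv : IsUnit (coord (ρ' β) j)) (h : chPoint ρ h2 hm hd hu = chPoint ρ' h2 hm' hd' hv) :
    (∀ γ, (ρ γ).trace = (ρ' γ).trace) ∧ IsUnit (derivOf ρ' hv α) ∧
      ∀ γ, derivOf ρ' hv γ = derivOf ρ hu γ * derivOf ρ' hv α := by
  obtain ⟨hg, hfg⟩ := projPoint_eq_projPoint _ (symD_mem α) one_pos (symD_mem β) one_pos _ _ h
  refine ⟨fun γ ↦ ?_, ?_, fun γ ↦ ?_⟩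
  · have hx : algebraMap _ (SymmetricAlgebra (RepRing 1 Γ) (Omega Γ)) (univChar Γ γ) ∈
        symGrading (RepRing 1 Γ) (Omega Γ) (0 • 1) := by
      rw [zero_smul]
      exact (algebraMap _ (symGrading (RepRing 1 Γ) (Omega Γ) 0) (univChar Γ γ)).2
    have e1 := awayLift_mk _ (unipHom ρ h2 hm hd hu) (isUnit_unipHom ρ h2 hm hd hu) (symD_mem α)
      0 _ hx
    have e2 := awayLift_mk _ (unipHom ρ' h2 hm' hd' hv) hg (symD_mem α) 0 _ hx
    have f1 : unipHom ρ h2 hm hd hu (algebraMap _ _ (univChar Γ γ)) = halfTrace h2 (ρ γ) := by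
      rw [unipHom, chHom_algebraMap, charHom_univChar]; rfl
    have f2 : unipHom ρ' h2 hm' hd' hv (algebraMap _ _ (univChar Γ γ)) = halfTrace h2 (ρ' γ) := by
      rw [unipHom, chHom_algebraMap, charHom_univChar]; rfl
    rw [pow_zero, mul_one, f1] at e1
    rw [pow_zero, mul_one, f2] at e2
    rw [← two_mul_halfTrace h2, ← two_mul_halfTrace h2]
    congr 1
    exact e1.symm.trans (congr($hfg _).trans e2)
  · rwa [unipHom, chHom_symD] at hg
  · have e1 := awayLift_mk _ (unipHom ρ h2 hm hd hu) (isUnit_unipHom ρ h2 hm hd hu) (symD_mem α)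
      1 (symD γ) (symD_mem γ)
    have e2 := awayLift_mk _ (unipHom ρ' h2 hm' hd' hv) hg (symD_mem α) 1 (symD γ) (symD_mem γ)
    have f1 (γ) : unipHom ρ h2 hm hd hu (symD γ) = derivOf ρ hu γ := chHom_symD ..
    have f2 (γ) : unipHom ρ' h2 hm' hd' hv (symD γ) = derivOf ρ' hv γ := chHom_symD ..
    rw [f1, f1, derivOf_self, pow_one, mul_one] at e1
    rw [← hfg, e1, f2, f2, pow_one] at e2
    exact e2.symm

/-- A matrix `N` with `N² = 0` and trace `0` which has an invertible off-diagonal entry is conjugate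
to `E₁₂`: if `v` is a vector of the standard basis such that `Nv` and `v` form a basis, then `N` is
`E₁₂` in this basis. -/
lemma exists_matAut_single {R : Type*} [CommRing R] {N : Matrix (Fin 2) (Fin 2) R}
    (htr : N.trace = 0) (hN : N * N = 0) (hu : IsUnit (N 0 1) ∨ IsUnit (N 1 0)) :
    ∃ φ : MatAut R, φ (Matrix.single 0 1 1) = N := by
  suffices h : ∃ P : Matrix (Fin 2) (Fin 2) R, IsUnit P ∧ N * P = P * Matrix.single 0 1 1 by
    obtain ⟨_, ⟨P, rfl⟩, h⟩ := h
    refine ⟨MulSemiringAction.toAlgEquiv R _ (ConjAct.toConjAct P), ?_⟩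
    rw [MulSemiringAction.toAlgEquiv_apply, ConjAct.units_smul_def, ConjAct.ofConjAct_toConjAct,
      ← h, mul_assoc, Units.mul_inv, mul_one]
  rw [Matrix.trace_fin_two] at htr
  have h11 : N 1 1 = -N 0 0 := by linear_combination htr
  have h00 : N 0 0 * N 0 0 + N 0 1 * N 1 0 = 0 := by
    simpa [Matrix.mul_apply, Fin.sum_univ_two] using congr($hN 0 0)
  obtain hu | hu := hu
  · refine ⟨!![N 0 1, 0; N 1 1, 1], ?_, ?_⟩
    · rw [Matrix.isUnit_iff_isUnit_det, Matrix.det_fin_two]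
      simpa using hu
    · ext i j
      fin_cases i <;> fin_cases j <;>
        simp [Matrix.mul_apply, Fin.sum_univ_two, h11] <;> first | ring1 | linear_combination h00
  · refine ⟨!![N 0 0, 1; N 1 0, 0], ?_, ?_⟩
    · rw [Matrix.isUnit_iff_isUnit_det, Matrix.det_fin_two]
      simpa using hu
    · ext i j
      fin_cases i <;> fin_cases j <;>
        simp [Matrix.mul_apply, Fin.sum_univ_two, h11] <;> first | ring1 | linear_combination h00

/-- Representations with the same character and the same derivation are conjugate, provided that
their nilpotent parts have invertible off-diagonal entries. -/
lemma exists_conjRep_eq {R : Type u} [CommRing R] {ρ ρ' : Γ →* Matrix (Fin 2) (Fin 2) R}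
    (h2 : IsUnit (2 : R)) (hm : ∀ g r, minor ρ g r = 0) (hd : ∀ γ, disc (ρ γ) = 0)
    (hm' : ∀ g r, minor ρ' g r = 0) (hd' : ∀ γ, disc (ρ' γ) = 0) {α : Γ} {i j : Fin 3}
    (hi : i ≠ 2) (hj : j ≠ 2) (hu : IsUnit (coord (ρ α) i)) (hv : IsUnit (coord (ρ' α) j))
    (htr : ∀ γ, (ρ γ).trace = (ρ' γ).trace) (ha : ∀ γ, derivOf ρ' hv γ = derivOf ρ hu γ) :
    ∃ φ : MatAut R, conjRep ρ φ = ρ' := by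
  have key {X : Matrix (Fin 2) (Fin 2) R} (hX : disc X = 0) {i : Fin 3} (hi : i ≠ 2)
      (hu : IsUnit (coord X i)) : ∃ φ : MatAut R, φ (Matrix.single 0 1 1) = eta h2 X := by
    refine exists_matAut_single (trace_eta h2 X) (eta_mul_eta h2 hX) ?_
    rw [← coord_eta h2] at hu
    fin_cases i
    · exact .inl hu
    · exact .inr hu
    · exact absurd rfl hi
  obtain ⟨φ, hφ⟩ := key (hd α) hi hu
  obtain ⟨ψ, hψ⟩ := key (hd' α) hj hv
  refine ⟨φ * ψ⁻¹, MonoidHom.ext fun γ ↦ ?_⟩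
  rw [conjRep_apply, AlgEquiv.symm_apply_eq, rep_eq h2 hm hu γ, rep_eq h2 hm' hv γ, map_add,
    map_smul, map_smul, map_one, ← hψ, ← hφ, halfTrace, halfTrace, htr]
  change _ + derivOf ρ hu γ • _ = _ + derivOf ρ' hv γ • φ (ψ.symm (ψ _))
  rw [ψ.symm_apply_apply, ha]

/-- Where a nilpotent matrix does not vanish, one of its off-diagonal entries does not. -/
lemma IsUnipotentRep.exists_mem_basicOpen_offDiag {T : Scheme.{u}} {ρ : RepOn Γ T}
    (h : IsUnipotentRep ρ) (t : T) : ∃ α i, i ≠ 2 ∧ t ∈ T.basicOpen (coord (ρ α) i) := by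
  obtain ⟨α, i, hi⟩ := h.exists_mem_basicOpen t
  by_cases h' : i = 2
  · subst h'
    refine ⟨α, 0, by decide, ?_⟩
    have e : coord (ρ α) 2 ^ 2 = coord (ρ α) 0 * (-4 * coord (ρ α) 1) := by
      have := h.disc_eq_zero α
      rw [disc, Matrix.trace_fin_two, Matrix.det_fin_two] at this
      simp [coord]
      linear_combination this
    rw [← T.basicOpen_pow (coord (ρ α) 2) two_pos, e, Scheme.basicOpen_mul] at hi
    exact hi.1
  · exact ⟨α, i, h', hi⟩

variable (Γ) in
/-- Two representations with the same image in `Ch₂(Γ)_u` have the same character `r`, and after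
normalizing the same derivation `a`; so they are `r + aN` and `r + aN'` with nowhere vanishing
nilpotent matrices `N` and `N'`, which are both locally conjugate to `E₁₂`. -/
theorem locallyConjugate_actionU_piU : LocallyConjugate (actionU Γ) (piU Γ) := by
  intro T x₁ x₂ hx t
  have hρ : IsUnipotentRep (pointRep x₁.left) := isUnipotentRep_pointRep _
  have hρ' : IsUnipotentRep (pointRep x₂.left) := isUnipotentRep_pointRep _
  set ρ : RepOn Γ T.left := pointRep x₁.left
  set ρ' : RepOn Γ T.left := pointRep x₂.left
  obtain ⟨α, i, hi, hti⟩ := hρ.exists_mem_basicOpen_offDiag t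
  obtain ⟨β, j, hj, htj⟩ := hρ'.exists_mem_basicOpen_offDiag t
  let U : T.left.Opens := T.left.basicOpen (coord (ρ α) i) ⊓ T.left.basicOpen (coord (ρ' β) j)
  have h2 := isUnit_two_map U.ι hρ.isUnit_two
  have hm := mapRep_minor U.ι hρ.minor_eq_zero
  have hd := mapRep_disc U.ι hρ.disc_eq_zero
  have hm' := mapRep_minor U.ι hρ'.minor_eq_zero
  have hd' := mapRep_disc U.ι hρ'.disc_eq_zero
  have hu : IsUnit (coord (mapRep U.ι.appTop.hom ρ α) i) := isUnit_coord_mapRep_of_le inf_le_left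
  have hv : IsUnit (coord (mapRep U.ι.appTop.hom ρ' β) j) := isUnit_coord_mapRep_of_le inf_le_right
  have hch : chPoint (mapRep U.ι.appTop.hom ρ) h2 hm hd hu =
      chPoint (mapRep U.ι.appTop.hom ρ') h2 hm' hd' hv := by
    rw [← comp_piU (U.ι ≫ x₁.left) (by rw [pointRep_comp]) h2 hm hd hu,
      ← comp_piU (U.ι ≫ x₂.left) (by rw [pointRep_comp]) h2 hm' hd' hv, Category.assoc,
      Category.assoc]
    exact congr(U.ι ≫ $(hx).left)
  obtain ⟨htr, hα, ha⟩ := trace_eq_and_derivOf_eq_of_chPoint_eq h2 hm hd hm' hd' hu hv hch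
  -- the derivation of `ρ'` may be normalized at `α` as well
  have hw : IsUnit (coord (mapRep U.ι.appTop.hom ρ' α) j) := by
    rw [← derivOf_mul_coord _ hv]
    exact hα.mul hv
  obtain ⟨φ, hφ⟩ := exists_conjRep_eq h2 hm hd hm' hd' hi hj hu hw htr fun γ ↦ by
    apply hw.mul_right_cancel
    rw [derivOf_mul_coord, ← derivOf_mul_coord _ hv, ha, mul_assoc, derivOf_mul_coord]
  refine ⟨U, Over.homMk (toPGL h2 φ) (Subsingleton.elim _ _), ⟨hti, htj⟩,
    Over.OverMorphism.ext (pointRep_injective ?_)⟩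
  rw [pointRep_comp_actionU, lift_fst, lift_snd, Over.comp_left, Over.comp_left, pointRep_comp,
    pointRep_comp]
  exact hφ.symm.trans (congrArg _ (pglAut_toPGL h2 φ).symm)

end Conjugacy

end UnipotentMold

open UnipotentMold
theorem mainTheorem6 (Γ : Type u) [Monoid Γ] :
    (∀ T : Over SHalf.{u}, Set.BijOn (fun f : T ⟶ RepU Γ ↦ pointRep f.left) Set.univ
      {ρ : RepOn Γ T.left | HasUnipotentMold ρ}) ∧
    IsRightAction (actionU Γ) ∧
    IsUniversalGeometricQuotient (actionU Γ) (piU Γ) :=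
  ⟨bijOn_pointRep, isRightAction_actionU Γ, isUniversalGeometricQuotient_of_local
    (actionU_comp_piU Γ) (hasLocalSections_piU Γ) (locallyConjugate_actionU_piU Γ)⟩
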